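/- For $0<p\le\infty$ and $n\in\mathbb N=\{1,2,\dots\}$ let $\ell_p^n(\mathbb C)$ be $\mathbb C^n$ with the (quasi-)norm $\|x\|_p=\bigl(\sum_{i=1}^n|x_i|^p\bigr)^{1/p}$ if $p<\infty$ and $\|x\|_\infty=\max_{1\le i\le n}|x_i|$, and let $B_p=\{x\in\mathbb C^n:\|x\|_p\le1\}$ be its unit ball. For $k\in\mathbb N$, the $k$-th (dyadic) entropy number of the identity $id:\ell_p^n(\mathbb C)\to\ell_q^n(\mathbb C)$ is $$e_k(id:\ell_p^n(\mathbb C)\to\ell_q^n(\mathbb C))=\inf\Bigl\{r>0:\ \exists\,y_1,\dots,y_{2^{k-1}}\in\mathbb C^n\ \text{with}\ B_p\subset\bigcup_{j=1}^{2^{k-1}}(y_j+rB_q)\Bigr\}.$$ Theorem. Let $0<p,q\le\infty$, with the convention $1/\infty=0$. a) If $p\le q$, then for all $n,k\in\mathbb N$ $$e_k(id:\ell_p^n(\mathbb C)\to\ell_q^n(\mathbb C))\sim\begin{cases}1&\text{if }1\le k\le\log_2(2n),\\ \Bigl(\dfrac{\log_2(1+2n/k)}{k}\Bigr)^{\frac1p-\frac1q}&\text{if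 }\log_2(2n)\le k\le 2n,\\ 2^{-\frac{k-1}{2n}}\,n^{\frac1q-\frac1p}&\text{if }2n\le k.\end{cases}$$ b) If $q\le p$, then for all $n,k\in\mathbb N$ $$e_k(id:\ell_p^n(\mathbb C)\to\ell_q^n(\mathbb C))\sim 2^{-\frac{k-1}{2n}}\,n^{\frac1q-\frac1p}.$$ Here $A\sim B$ means that $c\,B\le A\le C\,B$ with constants $c,C>0$ that may depend on $p$ and $q$ but not on $k$ and $n$. -/

import Mathlib

open scoped ENNReal Pointwise

/-- The closed unit ball `B_X = {x ∈ X : ‖x‖ ≤ 1}` of a space with a (quasi-)norm. -/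
def unitBall (X : Type*) [Norm X] : Set X := {x | ‖x‖ ≤ 1}

/-- The `k`-th dyadic entropy number (`k ≥ 1`) of a linear operator `T : X → Y`: the infimum of
all `r > 0` such that `T(B_X)` is covered by `2^(k-1)` translates of `r B_Y`.
Only the functional `‖·‖` is used, so that quasi-norms are allowed. -/
noncomputable def entropyNumber {𝕜 X Y : Type*} [RCLike 𝕜]
    [AddCommGroup X] [Module 𝕜 X] [Norm X] [AddCommGroup Y] [Module 𝕜 Y] [Norm Y]
    (k : ℕ) (T : X →ₗ[𝕜] Y) : ℝ :=
  sInf {r : ℝ | 0 < r ∧ ∃ y : Fin (2 ^ (k - 1)) → Y,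
    T '' unitBall X ⊆ ⋃ j, (y j +ᵥ ((r : 𝕜) • unitBall Y))}

/-- The space `ℓ_p^n(ℂ)`, i.e. `ℂ^n` with `‖x‖_p = (∑ |x_i|^p)^(1/p)` for `0 < p < ∞` and
`‖x‖_∞ = max |x_i|`. Mathlib's `‖·‖` on `PiLp` is this (quasi-)norm for every `0 < p ≤ ∞`. -/
abbrev EllC (p : ℝ≥0∞) (n : ℕ) : Type := PiLp p (fun _ : Fin n => ℂ)

/-- The identity `id : ℓ_p^n(ℂ) → ℓ_q^n(ℂ)`. -/
def idC (p q : ℝ≥0∞) (n : ℕ) : EllC p n →ₗ[ℂ] EllC q n :=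
  (WithLp.linearEquiv q ℂ (Fin n → ℂ)).symm.toLinearMap ∘ₗ
    (WithLp.linearEquiv p ℂ (Fin n → ℂ)).toLinearMap

/-! Upper bounds come from rounding coordinates to a square lattice of mesh `m^(-1/p)`. The error is
dominated coordinatewise by both the vector and the mesh, so for `p ≤ q` its `ℓ_q` norm is at most
`m^(1/q-1/p)` (`ellNorm_le_of_dominated`). For finite `p` an exponential-moment count shows that at
most `exp(C m (1 + log(1 + n/m)))` rounded vectors occur (`exists_lattice_cover`). Taking `m ≈ k /
log₂(1 + 2n/k)` gives the middle range. Taking `m = n` covers `B_p` by `A^n` polydiscs of radius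
`n^(-1/p)` (`exists_sup_cover`), and subdividing these gives the decay `2^(-(k-1)/(2n))`, where `2n`
is the real dimension.

Lower bounds have two sources. Comparing volumes of polydiscs gives the rate `2^(-(k-1)/(2n))
n^(1/q-1/p)` for all `k` and `n` (`le_entropyNumber_volume`). For `k` small relative to `n`, many
`m`-sparse vectors with supports differing in a fixed proportion of places force a large radius
(`le_entropyNumber_sparse`). -/

/-! ### Quasi-norm inequalities on `ℂ^n`. -/

/-- The `ℓ_p` (quasi-)norm of a vector in `ℂ^n`. -/
noncomputable def ellNorm (p : ℝ≥0∞) {n : ℕ} (x : Fin n → ℂ) : ℝ :=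
  ‖(WithLp.toLp p x : EllC p n)‖

theorem toReal_one_div_top : (1 / (∞ : ℝ≥0∞)).toReal = 0 := by simp

theorem toReal_one_div {p : ℝ≥0∞} : (1 / p).toReal = p.toReal⁻¹ := by
  simp [ENNReal.toReal_inv]

theorem toReal_one_div_nonneg (p : ℝ≥0∞) : 0 ≤ (1 / p).toReal := ENNReal.toReal_nonneg

theorem toReal_one_div_anti {p q : ℝ≥0∞} (hp : 0 < p) (h : p ≤ q) :
    (1 / q).toReal ≤ (1 / p).toReal := by
  apply ENNReal.toReal_mono
  · simp [hp.ne']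
  · simpa using h

theorem ellNorm_le_iff {p : ℝ≥0∞} (hp : 0 < p) (hp' : p ≠ ∞) {n : ℕ} {x : Fin n → ℂ} {r : ℝ}
    (hr : 0 ≤ r) : ellNorm p x ≤ r ↔ ∑ i, ‖x i‖ ^ p.toReal ≤ r ^ p.toReal := by
  have h0 : 0 < p.toReal := ENNReal.toReal_pos hp.ne' hp'
  have hs : 0 ≤ ∑ i, ‖x i‖ ^ p.toReal := Finset.sum_nonneg fun i _ => by positivity
  rw [ellNorm, PiLp.norm_eq_sum h0, one_div, Real.rpow_inv_le_iff_of_pos hs hr h0]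

theorem ellNorm_top_le_iff {n : ℕ} {x : Fin n → ℂ} {r : ℝ} (hr : 0 ≤ r) :
    ellNorm ∞ x ≤ r ↔ ∀ i, ‖x i‖ ≤ r := by
  rw [ellNorm, PiLp.norm_eq_ciSup]
  constructor
  · intro h i
    exact (le_ciSup (f := fun i => ‖x i‖) (Set.finite_range _).bddAbove i).trans h
  · intro h
    exact Real.iSup_le h hr

theorem norm_apply_le_of_ellNorm_le {p : ℝ≥0∞} (hp : 0 < p) {n : ℕ} {x : Fin n → ℂ} {r : ℝ}
    (hr : 0 ≤ r) (h : ellNorm p x ≤ r) (i : Fin n) : ‖x i‖ ≤ r := by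
  by_cases hp' : p = ∞
  · subst hp'
    exact (ellNorm_top_le_iff hr).1 h i
  · have h0 : 0 < p.toReal := ENNReal.toReal_pos hp.ne' hp'
    rw [ellNorm_le_iff hp hp' hr] at h
    rw [← Real.rpow_le_rpow_iff (norm_nonneg _) hr h0]
    exact (Finset.single_le_sum (f := fun i => ‖x i‖ ^ p.toReal) (fun i _ => by positivity)
      (Finset.mem_univ i)).trans h

theorem ellNorm_le_of_forall_norm_le {p : ℝ≥0∞} (hp : 0 < p) {n : ℕ} {x : Fin n → ℂ} {r : ℝ}
    (hr : 0 ≤ r) (h : ∀ i, ‖x i‖ ≤ r) : ellNorm p x ≤ (n : ℝ) ^ (1 / p).toReal * r := by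
  by_cases hp' : p = ∞
  · subst hp'
    rw [toReal_one_div_top, Real.rpow_zero, one_mul]
    exact (ellNorm_top_le_iff hr).2 h
  · have h0 : 0 < p.toReal := ENNReal.toReal_pos hp.ne' hp'
    rw [ellNorm_le_iff hp hp' (by positivity), Real.mul_rpow (by positivity) hr,
      toReal_one_div, Real.rpow_inv_rpow (by positivity) h0.ne']
    calc ∑ i, ‖x i‖ ^ p.toReal ≤ ∑ _i : Fin n, r ^ p.toReal :=
          Finset.sum_le_sum fun i _ => Real.rpow_le_rpow (norm_nonneg _) (h i) h0.le
      _ = n * r ^ p.toReal := by simp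

theorem ellNorm_smul {p : ℝ≥0∞} (hp : 0 < p) {n : ℕ} (c : ℂ) (x : Fin n → ℂ) :
    ellNorm p (c • x) = ‖c‖ * ellNorm p x := by
  by_cases hp' : p = ∞
  · subst hp'
    simp only [ellNorm, PiLp.norm_eq_ciSup, Pi.smul_apply, norm_smul]
    rw [Real.mul_iSup_of_nonneg (norm_nonneg c)]
  · have h0 : 0 < p.toReal := ENNReal.toReal_pos hp.ne' hp'
    have hs : 0 ≤ ∑ i, ‖x i‖ ^ p.toReal := Finset.sum_nonneg fun i _ => by positivity
    simp only [ellNorm, PiLp.norm_eq_sum h0, Pi.smul_apply, norm_smul,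
      Real.mul_rpow (norm_nonneg c) (norm_nonneg _)]
    rw [← Finset.mul_sum, Real.mul_rpow (by positivity) hs, one_div,
      Real.rpow_rpow_inv (norm_nonneg _) h0.ne']

/-- `|a - b| ≤ 2 max(|a|, |b|)`, and a power of the maximum is at most the sum of the powers. The
cruder constant avoids separating `p < 1` from `p ≥ 1`. -/
theorem ellNorm_sub_le {p : ℝ≥0∞} (hp : 0 < p) {n : ℕ} {x y : Fin n → ℂ} {r : ℝ}
    (hr : 0 ≤ r) (hx : ellNorm p x ≤ r) (hy : ellNorm p y ≤ r) :
    ellNorm p (x - y) ≤ 2 * 2 ^ (1 / p).toReal * r := by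
  by_cases hp' : p = ∞
  · subst hp'
    rw [toReal_one_div_top, Real.rpow_zero, mul_one]
    rw [ellNorm_top_le_iff hr] at hx hy
    rw [ellNorm_top_le_iff (by positivity)]
    intro i
    exact (norm_sub_le _ _).trans (by linarith [hx i, hy i])
  · have h0 : 0 < p.toReal := ENNReal.toReal_pos hp.ne' hp'
    rw [ellNorm_le_iff hp hp' hr] at hx hy
    rw [ellNorm_le_iff hp hp' (by positivity), Real.mul_rpow (by positivity) hr,
      Real.mul_rpow (by positivity) (by positivity),
      toReal_one_div, Real.rpow_inv_rpow (by positivity) h0.ne']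
    calc ∑ i, ‖(x - y) i‖ ^ p.toReal
        ≤ ∑ i, 2 ^ p.toReal * (‖x i‖ ^ p.toReal + ‖y i‖ ^ p.toReal) := by
          refine Finset.sum_le_sum fun i _ => ?_
          have h1 : ‖(x - y) i‖ ≤ 2 * max ‖x i‖ ‖y i‖ :=
            (norm_sub_le _ _).trans (by
              linarith [le_max_left ‖x i‖ ‖y i‖, le_max_right ‖x i‖ ‖y i‖])
          refine (Real.rpow_le_rpow (norm_nonneg _) h1 h0.le).trans ?_
          rw [Real.mul_rpow (by positivity) (by positivity)]
          gcongr
          rcases max_choice ‖x i‖ ‖y i‖ with h | h <;> rw [h]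
          · have : 0 ≤ ‖y i‖ ^ p.toReal := by positivity
            linarith
          · have : 0 ≤ ‖x i‖ ^ p.toReal := by positivity
            linarith
      _ = 2 ^ p.toReal * (∑ i, ‖x i‖ ^ p.toReal + ∑ i, ‖y i‖ ^ p.toReal) := by
          rw [← Finset.mul_sum, Finset.sum_add_distrib]
      _ ≤ 2 ^ p.toReal * (r ^ p.toReal + r ^ p.toReal) := by gcongr
      _ = 2 ^ p.toReal * 2 * r ^ p.toReal := by ring

/-- A vector dominated by a vector of the unit ball of `ℓ_p` and with entries at most
`m^(-1/p)` has `ℓ_q` norm at most `m^(1/q-1/p)`. -/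
theorem ellNorm_le_of_dominated {p q : ℝ≥0∞} (hp : 0 < p) (hpq : p ≤ q) {n : ℕ}
    {x y : Fin n → ℂ} {m : ℝ} (hm : 0 < m) (hx : ellNorm p x ≤ 1) (hxy : ∀ i, ‖y i‖ ≤ ‖x i‖)
    (hy : ∀ i, ‖y i‖ ≤ m ^ (-(1 / p).toReal)) :
    ellNorm q y ≤ m ^ ((1 / q).toReal - (1 / p).toReal) := by
  by_cases hq' : q = ∞
  · subst hq'
    rw [toReal_one_div_top, zero_sub]
    exact (ellNorm_top_le_iff (by positivity)).2 hy
  · have hp' : p ≠ ∞ := ne_top_of_le_ne_top hq' hpq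
    have hq : 0 < q := hp.trans_le hpq
    have h0 : 0 < p.toReal := ENNReal.toReal_pos hp.ne' hp'
    have h1 : 0 < q.toReal := ENNReal.toReal_pos hq.ne' hq'
    have h2 : p.toReal ≤ q.toReal := ENNReal.toReal_mono hq' hpq
    rw [ellNorm_le_iff hp hp' zero_le_one, Real.one_rpow] at hx
    rw [ellNorm_le_iff hq hq' (by positivity)]
    rw [toReal_one_div] at hy
    rw [toReal_one_div, toReal_one_div]
    calc ∑ i, ‖y i‖ ^ q.toReal
        ≤ ∑ i, (m ^ (-p.toReal⁻¹)) ^ (q.toReal - p.toReal) * ‖x i‖ ^ p.toReal := by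
          refine Finset.sum_le_sum fun i _ => ?_
          calc ‖y i‖ ^ q.toReal = ‖y i‖ ^ (q.toReal - p.toReal) * ‖y i‖ ^ p.toReal := by
                rw [← Real.rpow_add_of_nonneg (norm_nonneg _) (by linarith) h0.le]
                congr 1; ring
            _ ≤ _ := by
                exact mul_le_mul (Real.rpow_le_rpow (norm_nonneg _) (hy i) (by linarith))
                  (Real.rpow_le_rpow (norm_nonneg _) (hxy i) h0.le) (by positivity)
                  (by positivity)
      _ = (m ^ (-p.toReal⁻¹)) ^ (q.toReal - p.toReal) * ∑ i, ‖x i‖ ^ p.toReal := by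
          rw [← Finset.mul_sum]
      _ ≤ (m ^ (-p.toReal⁻¹)) ^ (q.toReal - p.toReal) * 1 := by gcongr
      _ = (m ^ (q.toReal⁻¹ - p.toReal⁻¹)) ^ q.toReal := by
          rw [mul_one, ← Real.rpow_mul hm.le, ← Real.rpow_mul hm.le]
          congr 1
          field_simp
          ring

theorem ellNorm_le_one_of_le {p q : ℝ≥0∞} (hp : 0 < p) (hpq : p ≤ q) {n : ℕ}
    {x : Fin n → ℂ} (hx : ellNorm p x ≤ 1) : ellNorm q x ≤ 1 := by
  have := ellNorm_le_of_dominated hp hpq (m := 1) one_pos hx (fun i => le_rfl) (fun i => by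
    rw [Real.one_rpow]; exact norm_apply_le_of_ellNorm_le hp zero_le_one hx i)
  rwa [Real.one_rpow] at this

/-- Power mean inequality with exponent `p/q ≥ 1`, applied to the numbers `|x_i|^q`. -/
theorem ellNorm_le_rpow_of_ge {p q : ℝ≥0∞} (hq : 0 < q) (hqp : q ≤ p) {n : ℕ} (hn : 1 ≤ n)
    {x : Fin n → ℂ} (hx : ellNorm p x ≤ 1) :
    ellNorm q x ≤ (n : ℝ) ^ ((1 / q).toReal - (1 / p).toReal) := by
  have hp : 0 < p := hq.trans_le hqp
  have hn' : (0 : ℝ) < n := by exact_mod_cast hn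
  by_cases hp' : p = ∞
  · subst hp'
    rw [toReal_one_div_top, sub_zero]
    simpa using ellNorm_le_of_forall_norm_le hq zero_le_one
      (fun i => norm_apply_le_of_ellNorm_le hp zero_le_one hx i)
  · have hq' : q ≠ ∞ := ne_top_of_le_ne_top hp' hqp
    have h0 : 0 < p.toReal := ENNReal.toReal_pos hp.ne' hp'
    have h1 : 0 < q.toReal := ENNReal.toReal_pos hq.ne' hq'
    have h2 : q.toReal ≤ p.toReal := ENNReal.toReal_mono hp' hqp
    rw [ellNorm_le_iff hp hp' zero_le_one, Real.one_rpow] at hx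
    rw [ellNorm_le_iff hq hq' (by positivity), toReal_one_div, toReal_one_div]
    have h3 : 1 ≤ p.toReal / q.toReal := (one_le_div h1).2 h2
    have h4 := Real.rpow_sum_le_const_mul_sum_rpow (Finset.univ : Finset (Fin n))
      (fun i => ‖x i‖ ^ q.toReal) h3
    have h5 : ∀ i, |‖x i‖ ^ q.toReal| ^ (p.toReal / q.toReal) = ‖x i‖ ^ p.toReal := fun i => by
      rw [abs_of_nonneg (by positivity), ← Real.rpow_mul (norm_nonneg _)]
      congr 1
      field_simp
    have h6 : ∀ i, |‖x i‖ ^ q.toReal| = ‖x i‖ ^ q.toReal := fun i => abs_of_nonneg (by positivity)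
    simp only [h5] at h4
    simp only [h6, Finset.card_univ, Fintype.card_fin] at h4
    have h7 : (∑ i, ‖x i‖ ^ q.toReal) ^ (p.toReal / q.toReal)
        ≤ (n : ℝ) ^ (p.toReal / q.toReal - 1) :=
      h4.trans (mul_le_of_le_one_right (by positivity) hx)
    have hs : 0 ≤ ∑ i, ‖x i‖ ^ q.toReal := Finset.sum_nonneg fun i _ => by positivity
    rw [← Real.rpow_le_rpow_iff hs (by positivity) (lt_of_lt_of_le one_pos h3)]
    refine h7.trans_eq ?_
    rw [← Real.rpow_mul hn'.le, ← Real.rpow_mul hn'.le]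
    congr 1
    field_simp

/-! ### Entropy numbers in terms of finite covers. -/

theorem mem_vadd_smul_unitBall {q : ℝ≥0∞} (hq : 0 < q) {n : ℕ} {r : ℝ} (hr : 0 < r)
    (x y : EllC q n) :
    x ∈ y +ᵥ ((r : ℂ) • unitBall (EllC q n)) ↔ ellNorm q (x.ofLp - y.ofLp) ≤ r := by
  have hr' : (r : ℂ) ≠ 0 := by exact_mod_cast hr.ne'
  rw [Set.mem_vadd_set_iff_neg_vadd_mem, Set.mem_smul_set_iff_inv_smul_mem₀ hr']
  have : ‖(r : ℂ)⁻¹ • (-y +ᵥ x)‖ = r⁻¹ * ellNorm q (x.ofLp - y.ofLp) := by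
    have h := ellNorm_smul hq ((r : ℂ)⁻¹) (x.ofLp - y.ofLp)
    rw [norm_inv, Complex.norm_real, Real.norm_of_nonneg hr.le] at h
    rw [← h, ellNorm]
    congr 1
    rw [vadd_eq_add, neg_add_eq_sub]
    rfl
  change ‖(r : ℂ)⁻¹ • (-y +ᵥ x)‖ ≤ 1 ↔ _
  rw [this, inv_mul_le_iff₀ hr, mul_one]

theorem mem_entropy_set_iff {p q : ℝ≥0∞} (hq : 0 < q) {n k : ℕ} {r : ℝ} :
    (0 < r ∧ ∃ y : Fin (2 ^ (k - 1)) → EllC q n,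
      idC p q n '' unitBall (EllC p n) ⊆ ⋃ j, (y j +ᵥ ((r : ℂ) • unitBall (EllC q n)))) ↔
    (0 < r ∧ ∃ y : Fin (2 ^ (k - 1)) → Fin n → ℂ,
      ∀ x : Fin n → ℂ, ellNorm p x ≤ 1 → ∃ j, ellNorm q (x - y j) ≤ r) := by
  refine and_congr_right fun hr => ?_
  constructor
  · rintro ⟨y, hy⟩
    refine ⟨fun j => (y j).ofLp, fun x hx => ?_⟩
    have := hy ⟨WithLp.toLp p x, hx, rfl⟩
    obtain ⟨j, hj⟩ := Set.mem_iUnion.1 this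
    exact ⟨j, (mem_vadd_smul_unitBall hq hr _ _).1 hj⟩
  · rintro ⟨y, hy⟩
    refine ⟨fun j => WithLp.toLp q (y j), ?_⟩
    rintro _ ⟨x, hx, rfl⟩
    obtain ⟨j, hj⟩ := hy x.ofLp hx
    exact Set.mem_iUnion.2 ⟨j, (mem_vadd_smul_unitBall hq hr _ _).2 hj⟩

theorem entropyNumber_le_of_cover {p q : ℝ≥0∞} (hp : 0 < p) (hq : 0 < q) {n k : ℕ} {r : ℝ}
    (hr : 0 < r) (Z : Finset (Fin n → ℂ)) (hZ : Z.card ≤ 2 ^ (k - 1))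
    (h : ∀ x : Fin n → ℂ, ellNorm p x ≤ 1 → ∃ z ∈ Z, ellNorm q (x - z) ≤ r) :
    entropyNumber k (idC p q n) ≤ r := by
  refine csInf_le ⟨0, fun _ hr => hr.1.le⟩ ((mem_entropy_set_iff hq).2 ⟨hr, ?_⟩)
  -- The ball contains 0, so `Z` is nonempty; this lets `invFun` pad the centres to exactly
  -- `2^(k-1)`.
  obtain ⟨z₀, hz₀, -⟩ := h 0 ((ellNorm_le_of_forall_norm_le hp le_rfl (by simp)).trans (by simp))
  obtain ⟨e⟩ : Nonempty (Z ↪ Fin (2 ^ (k - 1))) :=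
    Function.Embedding.nonempty_of_card_le (by simpa using hZ)
  have : Nonempty Z := ⟨⟨z₀, hz₀⟩⟩
  refine ⟨fun j => (Function.invFun e j : Z), fun x hx => ?_⟩
  obtain ⟨z, hz, hxz⟩ := h x hx
  refine ⟨e ⟨z, hz⟩, ?_⟩
  simpa only [Function.leftInverse_invFun e.injective _] using hxz

theorem le_entropyNumber {p q : ℝ≥0∞} (hp : 0 < p) (hq : 0 < q) {n k : ℕ} {b : ℝ}
    (h : ∀ r : ℝ, 0 < r → ∀ y : Fin (2 ^ (k - 1)) → Fin n → ℂ,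
      (∀ x : Fin n → ℂ, ellNorm p x ≤ 1 → ∃ j, ellNorm q (x - y j) ≤ r) → b ≤ r) :
    b ≤ entropyNumber k (idC p q n) := by
  -- The infimum must be over a nonempty set: one ball of radius `n^(1/q) + 1` suffices, the `+ 1`
  -- keeping the radius positive for `n = 0`.
  refine le_csInf ⟨(n : ℝ) ^ (1 / q).toReal + 1, (mem_entropy_set_iff hq).2 ⟨by positivity, 0, ?_⟩⟩ ?_
  · intro x hx
    refine ⟨⟨0, by positivity⟩, ?_⟩
    have := ellNorm_le_of_forall_norm_le hq zero_le_one
      (fun i => norm_apply_le_of_ellNorm_le hp zero_le_one hx i)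
    simp only [Pi.zero_apply, sub_zero]
    linarith
  · intro r hr
    obtain ⟨hr, y, hy⟩ := (mem_entropy_set_iff hq).1 hr
    exact h r hr y hy

theorem entropyNumber_anti {p q : ℝ≥0∞} (hp : 0 < p) (hq : 0 < q) {n k l : ℕ} (hkl : k ≤ l) :
    entropyNumber l (idC p q n) ≤ entropyNumber k (idC p q n) := by
  refine le_entropyNumber hp hq fun r hr y hy => ?_
  classical
  refine entropyNumber_le_of_cover hp hq hr (Finset.univ.image y) ?_ fun x hx => ?_
  · refine Finset.card_image_le.trans ?_
    simpa using Nat.pow_le_pow_right (by norm_num) (by omega)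
  · obtain ⟨j, hj⟩ := hy x hx
    exact ⟨y j, by simp, hj⟩

theorem entropyNumber_le_of_ball_subset {p q : ℝ≥0∞} (hp : 0 < p) (hq : 0 < q) {n k : ℕ} {r : ℝ}
    (hr : 0 < r) (h : ∀ x : Fin n → ℂ, ellNorm p x ≤ 1 → ellNorm q x ≤ r) :
    entropyNumber k (idC p q n) ≤ r :=
  entropyNumber_le_of_cover hp hq hr {0} (by simpa using Nat.one_le_two_pow)
    fun x hx => ⟨0, by simp, by simpa using h x hx⟩

/-! ### Rounding to a lattice and counting lattice points. -/

/-- The point `δ (a + b i)` of the square lattice of mesh `δ`. -/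
noncomputable def gridPoint (δ : ℝ) (g : ℤ × ℤ) : ℂ := ⟨δ * g.1, δ * g.2⟩

/-- The lattice coordinates of `z` rounded to the square lattice of mesh `δ`. -/
noncomputable def gridRound (δ : ℝ) (z : ℂ) : ℤ × ℤ := (round (z.re / δ), round (z.im / δ))

/-- The second bound compares the nearest lattice point with 0. It makes the rounding error
dominated by the vector itself, as `ellNorm_le_of_dominated` requires. -/
theorem abs_sub_mul_round_le {δ : ℝ} (hδ : 0 < δ) (t : ℝ) :
    |t - δ * round (t / δ)| ≤ δ / 2 ∧ |t - δ * round (t / δ)| ≤ |t| := by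
  have h : t - δ * round (t / δ) = δ * (t / δ - round (t / δ)) := by field_simp
  rw [h, abs_mul, abs_of_pos hδ]
  constructor
  · have := abs_sub_round (t / δ)
    nlinarith
  · have := round_le (t / δ) 0
    rw [Int.cast_zero, sub_zero, abs_div, abs_of_pos hδ, le_div_iff₀ hδ] at this
    linarith

theorem norm_sub_gridPoint_le {δ : ℝ} (hδ : 0 < δ) (z : ℂ) :
    ‖z - gridPoint δ (gridRound δ z)‖ ≤ δ := by
  refine (Complex.norm_le_abs_re_add_abs_im _).trans ?_
  have h1 := (abs_sub_mul_round_le hδ z.re).1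
  have h2 := (abs_sub_mul_round_le hδ z.im).1
  simp only [gridPoint, gridRound, Complex.sub_re, Complex.sub_im]
  linarith

theorem norm_sub_gridPoint_le_norm {δ : ℝ} (hδ : 0 < δ) (z : ℂ) :
    ‖z - gridPoint δ (gridRound δ z)‖ ≤ ‖z‖ := by
  have h1 := sq_le_sq.2 (abs_sub_mul_round_le hδ z.re).2
  have h2 := sq_le_sq.2 (abs_sub_mul_round_le hδ z.im).2
  rw [Complex.norm_def, Complex.norm_def]
  apply Real.sqrt_le_sqrt
  rw [Complex.normSq_apply, Complex.normSq_apply]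
  simp only [gridPoint, gridRound, Complex.sub_re, Complex.sub_im]
  linarith

theorem abs_round_div_le {δ : ℝ} (hδ : 0 < δ) (t : ℝ) :
    |(round (t / δ) : ℝ)| ≤ 2 * |t| / δ := by
  have := round_le (t / δ) 0
  rw [Int.cast_zero, sub_zero] at this
  have h2 : |(round (t / δ) : ℝ)| ≤ |t / δ| + |t / δ - round (t / δ)| := by
    have := abs_sub (t / δ) (t / δ - round (t / δ))
    simpa using this
  have h3 : |t / δ| = |t| / δ := by rw [abs_div, abs_of_pos hδ]
  rw [h3] at this h2
  calc _ ≤ _ := h2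
    _ ≤ |t| / δ + |t| / δ := by linarith
    _ = 2 * |t| / δ := by ring

theorem abs_gridRound_le {δ : ℝ} (hδ : 0 < δ) (z : ℂ) :
    |((gridRound δ z).1 : ℝ)| ≤ 2 * ‖z‖ / δ ∧ |((gridRound δ z).2 : ℝ)| ≤ 2 * ‖z‖ / δ := by
  constructor
  · refine (abs_round_div_le hδ z.re).trans ?_
    gcongr
    exact Complex.abs_re_le_norm z
  · refine (abs_round_div_le hδ z.im).trans ?_
    gcongr
    exact Complex.abs_im_le_norm z

/-- The `t`-th power of the `ℓ_t` (quasi-)norm on `ℤ²`. -/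
noncomputable def latticeWeight (t : ℝ) (g : ℤ × ℤ) : ℝ := |(g.1 : ℝ)| ^ t + |(g.2 : ℝ)| ^ t

theorem latticeWeight_zero {t : ℝ} (ht : 0 < t) : latticeWeight t 0 = 0 := by
  simp [latticeWeight, Real.zero_rpow ht.ne']

theorem one_le_abs_rpow {t : ℝ} (ht : 0 < t) {a : ℤ} (ha : a ≠ 0) : 1 ≤ |(a : ℝ)| ^ t := by
  apply Real.one_le_rpow _ ht.le
  exact_mod_cast Int.one_le_abs ha

theorem one_le_latticeWeight {t : ℝ} (ht : 0 < t) {g : ℤ × ℤ} (hg : g ≠ 0) :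
    1 ≤ latticeWeight t g := by
  have h1 : 0 ≤ |(g.1 : ℝ)| ^ t := by positivity
  have h2 : 0 ≤ |(g.2 : ℝ)| ^ t := by positivity
  rw [latticeWeight]
  by_cases h : g.1 = 0
  · have h' : g.2 ≠ 0 := fun h' => hg (Prod.ext h h')
    linarith [one_le_abs_rpow ht h']
  · linarith [one_le_abs_rpow ht h]

theorem summable_exp_neg_nat_rpow {t : ℝ} (ht : 0 < t) :
    Summable fun a : ℕ => Real.exp (-(a : ℝ) ^ t) := by
  refine summable_of_isBigO_nat (Real.summable_nat_rpow.2 (by norm_num : (-2 : ℝ) < -1)) ?_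
  have h1 := (isLittleO_exp_neg_mul_rpow_atTop one_pos (-2 / t)).isBigO
  have h2 : Filter.Tendsto (fun a : ℕ => (a : ℝ) ^ t) Filter.atTop Filter.atTop :=
    (tendsto_rpow_atTop ht).comp tendsto_natCast_atTop_atTop
  refine (h1.comp_tendsto h2).congr (fun a => by simp) fun a => ?_
  simp only [Function.comp]
  rw [← Real.rpow_mul (by positivity)]
  congr 1
  field_simp

theorem summable_exp_neg_latticeWeight {t : ℝ} (ht : 0 < t) :
    Summable fun g : ℤ × ℤ => Real.exp (-latticeWeight t g) := by
  have h1 : Summable fun a : ℤ => Real.exp (-|(a : ℝ)| ^ t) := by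
    apply Summable.of_nat_of_neg
    · simpa using summable_exp_neg_nat_rpow ht
    · simpa using summable_exp_neg_nat_rpow ht
  refine (h1.mul_of_nonneg h1 (fun _ => (Real.exp_pos _).le)
    (fun _ => (Real.exp_pos _).le)).congr fun g => ?_
  rw [latticeWeight, ← Real.exp_add, neg_add]

/-- Only the origin contributes a term that does not decay in `a`; elsewhere the weight `w` is at
least 1, so `-a w ≤ -w + (1 - a)`. -/
theorem sum_exp_neg_mul_latticeWeight_le {t : ℝ} (ht : 0 < t) {a : ℝ} (ha : 1 ≤ a)
    (G : Finset (ℤ × ℤ)) :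
    ∑ g ∈ G, Real.exp (-a * latticeWeight t g)
      ≤ 1 + (∑' g, Real.exp (-latticeWeight t g)) * Real.exp (1 - a) := by
  calc ∑ g ∈ G, Real.exp (-a * latticeWeight t g)
      ≤ ∑ g ∈ G, ((if g = 0 then 1 else 0) + Real.exp (-latticeWeight t g) * Real.exp (1 - a)) := by
        refine Finset.sum_le_sum fun g _ => ?_
        split_ifs with h
        · rw [h, latticeWeight_zero ht, mul_zero, Real.exp_zero]
          have : 0 ≤ Real.exp (-0) * Real.exp (1 - a) := by positivity
          linarith
        · rw [zero_add, ← Real.exp_add]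
          apply Real.exp_le_exp.2
          nlinarith [one_le_latticeWeight ht h]
    _ = (∑ g ∈ G, if g = 0 then 1 else 0)
          + (∑ g ∈ G, Real.exp (-latticeWeight t g)) * Real.exp (1 - a) := by
        rw [Finset.sum_add_distrib, Finset.sum_mul]
    _ ≤ _ := by
        gcongr
        · rw [Finset.sum_ite_eq' G 0 (fun _ => (1 : ℝ))]
          split_ifs <;> norm_num
        · exact (summable_exp_neg_latticeWeight ht).sum_le_tsum _ fun _ _ => (Real.exp_pos _).le

-- Chernoff's argument: each counted point satisfies `1 ≤ exp(a M - a ∑ weight)`, and the sum of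
-- these exponentials factorises over the coordinates.
open Classical in
theorem card_sum_latticeWeight_le {t : ℝ} (ht : 0 < t) {a : ℝ} (ha : 1 ≤ a) (M : ℝ) (n : ℕ)
    (G : Finset (ℤ × ℤ)) :
    (((Fintype.piFinset fun _ : Fin n => G).filter
        fun f => ∑ i, latticeWeight t (f i) ≤ M).card : ℝ)
      ≤ Real.exp (a * M) *
        (1 + (∑' g, Real.exp (-latticeWeight t g)) * Real.exp (1 - a)) ^ n := by
  calc (((Fintype.piFinset fun _ : Fin n => G).filter
        fun f => ∑ i, latticeWeight t (f i) ≤ M).card : ℝ)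
      = ∑ f ∈ (Fintype.piFinset fun _ : Fin n => G).filter
          fun f => ∑ i, latticeWeight t (f i) ≤ M, (1 : ℝ) := by simp
    _ ≤ ∑ f ∈ (Fintype.piFinset fun _ : Fin n => G).filter
          fun f => ∑ i, latticeWeight t (f i) ≤ M,
          Real.exp (a * M) * ∏ i, Real.exp (-a * latticeWeight t (f i)) := by
        refine Finset.sum_le_sum fun f hf => ?_
        have hf' := (Finset.mem_filter.1 hf).2
        rw [← Real.exp_sum, ← Real.exp_add, ← Finset.mul_sum]
        apply Real.one_le_exp
        nlinarith
    _ ≤ ∑ f ∈ Fintype.piFinset fun _ : Fin n => G,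
          Real.exp (a * M) * ∏ i, Real.exp (-a * latticeWeight t (f i)) :=
        Finset.sum_le_sum_of_subset_of_nonneg (Finset.filter_subset _ _) fun _ _ _ => by positivity
    _ = Real.exp (a * M) * (∑ g ∈ G, Real.exp (-a * latticeWeight t g)) ^ n := by
        rw [← Finset.mul_sum, Finset.sum_prod_piFinset G
          (fun (_ : Fin n) g => Real.exp (-a * latticeWeight t g))]
        simp
    _ ≤ _ := by
        gcongr
        exact sum_exp_neg_mul_latticeWeight_le ht ha G

theorem exists_lattice_cover {p : ℝ≥0∞} (hp : 0 < p) (hp' : p ≠ ∞) :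
    ∃ C : ℝ, 1 ≤ C ∧ ∀ (n : ℕ) (m : ℝ), 0 < m → ∃ Z : Finset (Fin n → ℂ),
      (Z.card : ℝ) ≤ Real.exp (C * m * (1 + Real.log (1 + n / m))) ∧
      ∀ x : Fin n → ℂ, ellNorm p x ≤ 1 → ∃ z ∈ Z, ∀ i,
        ‖x i - z i‖ ≤ ‖x i‖ ∧ ‖x i - z i‖ ≤ m ^ (-(1 / p).toReal) := by
  classical
  have ht : 0 < p.toReal := ENNReal.toReal_pos hp.ne' hp'
  set t := p.toReal with htdef
  set S := ∑' g, Real.exp (-latticeWeight t g) with hS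
  have hS0 : 0 ≤ S := tsum_nonneg fun g => (Real.exp_pos _).le
  refine ⟨2 * 2 ^ t + S, ?_, ?_⟩
  · have : (1 : ℝ) ≤ 2 ^ t := Real.one_le_rpow (by norm_num) ht.le
    linarith
  intro n m hm
  set δ := m ^ (-(1 / p).toReal) with hδ
  have hδ0 : 0 < δ := by positivity
  have hδt : δ ^ t = m⁻¹ := by
    rw [hδ, toReal_one_div, Real.rpow_neg hm.le, Real.inv_rpow (by positivity),
      Real.rpow_inv_rpow hm.le ht.ne']
  -- The box only makes the set finite; its size does not enter the count.
  set R : ℤ := ⌈2 / δ⌉ with hR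
  set G : Finset (ℤ × ℤ) := Finset.Icc (-R) R ×ˢ Finset.Icc (-R) R with hG
  set F := (Fintype.piFinset fun _ : Fin n => G).filter
        fun f => ∑ i, latticeWeight t (f i) ≤ 2 * 2 ^ t * m with hF
  refine ⟨F.image fun f i => gridPoint δ (f i), ?_, ?_⟩
  · have hl : 0 ≤ Real.log (1 + n / m) := Real.log_nonneg (by
      have : 0 ≤ n / m := by positivity
      linarith)
    -- This `a` gives `exp(1 - a) = (1 + n/m)⁻¹`, so the `n`-th power stays below `exp(S m)`.
    have h1 := card_sum_latticeWeight_le ht (a := 1 + Real.log (1 + n / m)) (by linarith)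
      (2 * 2 ^ t * m) n G
    have h2 : ((F.image fun f i => gridPoint δ (f i)).card : ℝ) ≤ F.card := by
      exact_mod_cast Finset.card_image_le
    refine h2.trans (h1.trans ?_)
    have h3 : (1 : ℝ) - (1 + Real.log (1 + n / m)) = -Real.log (1 + n / m) := by ring
    rw [← hS, h3, Real.exp_neg, Real.exp_log (by positivity)]
    have h4 : (1 + S * (1 + n / m)⁻¹) ^ n ≤ Real.exp (S * m) := by
      calc (1 + S * (1 + n / m)⁻¹) ^ n ≤ (Real.exp (S * (1 + n / m)⁻¹)) ^ n := by
            gcongr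
            linarith [Real.add_one_le_exp (S * (1 + n / m)⁻¹)]
        _ = Real.exp (n * (S * (1 + n / m)⁻¹)) := by rw [Real.exp_nat_mul]
        _ ≤ Real.exp (S * m) := by
            apply Real.exp_le_exp.2
            have : n * (1 + n / m)⁻¹ ≤ m := by
              rw [← div_eq_mul_inv, div_le_iff₀ (by positivity), mul_add,
                mul_div_cancel₀ _ hm.ne']
              linarith
            calc n * (S * (1 + n / m)⁻¹) = S * (n * (1 + n / m)⁻¹) := by ring
              _ ≤ S * m := by gcongr
    calc _ ≤ Real.exp ((1 + Real.log (1 + n / m)) * (2 * 2 ^ t * m)) * Real.exp (S * m) := by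
          gcongr
      _ = Real.exp ((1 + Real.log (1 + n / m)) * (2 * 2 ^ t * m) + S * m) := by
          rw [Real.exp_add]
      _ ≤ _ := by
          apply Real.exp_le_exp.2
          have : 0 ≤ S * m * Real.log (1 + n / m) := by positivity
          nlinarith
  · intro x hx
    refine ⟨fun i => gridPoint δ (gridRound δ (x i)), ?_, fun i =>
      ⟨norm_sub_gridPoint_le_norm hδ0 _, norm_sub_gridPoint_le hδ0 _⟩⟩
    refine Finset.mem_image.2 ⟨fun i => gridRound δ (x i), Finset.mem_filter.2 ⟨?_, ?_⟩, rfl⟩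
    · rw [Fintype.mem_piFinset]
      intro i
      have h1 := norm_apply_le_of_ellNorm_le hp zero_le_one hx i
      have key : ∀ a : ℤ, |(a : ℝ)| ≤ 2 * ‖x i‖ / δ → a ∈ Finset.Icc (-R) R := by
        intro a ha
        have h2 : |(a : ℝ)| ≤ R := by
          refine ha.trans (le_trans ?_ (Int.le_ceil _))
          gcongr
          linarith
        rw [Finset.mem_Icc, ← abs_le]
        exact_mod_cast h2
      exact Finset.mem_product.2
        ⟨key _ (abs_gridRound_le hδ0 (x i)).1, key _ (abs_gridRound_le hδ0 (x i)).2⟩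
    · rw [ellNorm_le_iff hp hp' zero_le_one, Real.one_rpow] at hx
      calc ∑ i, latticeWeight t (gridRound δ (x i))
          ≤ ∑ i, 2 * 2 ^ t * m * ‖x i‖ ^ t := by
            refine Finset.sum_le_sum fun i _ => ?_
            have h3 : (2 * ‖x i‖ / δ) ^ t = 2 ^ t * m * ‖x i‖ ^ t := by
              rw [Real.div_rpow (by positivity) hδ0.le, Real.mul_rpow (by positivity)
                (by positivity), hδt, div_inv_eq_mul]
              ring
            have h1 := Real.rpow_le_rpow (abs_nonneg _) (abs_gridRound_le hδ0 (x i)).1 ht.le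
            have h2 := Real.rpow_le_rpow (abs_nonneg _) (abs_gridRound_le hδ0 (x i)).2 ht.le
            rw [h3] at h1 h2
            rw [latticeWeight]
            linarith
        _ = 2 * 2 ^ t * m * ∑ i, ‖x i‖ ^ t := by rw [Finset.mul_sum]
        _ ≤ 2 * 2 ^ t * m * 1 := by gcongr
        _ = _ := mul_one _

theorem exists_sup_cover {p : ℝ≥0∞} (hp : 0 < p) :
    ∃ A : ℝ, 1 ≤ A ∧ ∀ n : ℕ, 1 ≤ n → ∃ Z : Finset (Fin n → ℂ), (Z.card : ℝ) ≤ A ^ n ∧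
      ∀ x : Fin n → ℂ, ellNorm p x ≤ 1 → ∃ z ∈ Z, ∀ i,
        ‖x i - z i‖ ≤ (n : ℝ) ^ (-(1 / p).toReal) := by
  by_cases hp' : p = ∞
  · subst hp'
    refine ⟨1, le_rfl, fun n hn => ⟨{0}, by simp, fun x hx => ⟨0, by simp, fun i => ?_⟩⟩⟩
    rw [toReal_one_div_top, neg_zero, Real.rpow_zero]
    simpa using norm_apply_le_of_ellNorm_le hp zero_le_one hx i
  · obtain ⟨C, hC, h⟩ := exists_lattice_cover hp hp'
    refine ⟨Real.exp (C * (1 + Real.log 2)), Real.one_le_exp (by positivity), fun n hn => ?_⟩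
    have hn' : (0 : ℝ) < n := by exact_mod_cast hn
    obtain ⟨Z, hZ, hcov⟩ := h n n hn'
    refine ⟨Z, hZ.trans_eq ?_, fun x hx => ?_⟩
    · rw [← Real.exp_nat_mul, div_self hn'.ne', one_add_one_eq_two]
      congr 1
      ring
    · obtain ⟨z, hz, hxz⟩ := hcov x hx
      exact ⟨z, hz, fun i => (hxz i).2⟩

/-! ### Upper bound in the middle range. -/

/-- With `m = b² k / L` the bracket is at most `5 L / b`, so `L` cancels and `5 C b k = k/4`
remains. The square on `b` absorbs the `1/b` lost in the logarithm, and `k/4 ≤ (k - 1) log 2` uses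
`k ≥ 2`. -/
theorem lattice_exponent_le {C k n b L : ℝ} (hC : 1 ≤ C) (hk : 2 ≤ k)
    (hkn : k ≤ 2 * n) (hb : b = 1 / (20 * C)) (hL : L = Real.logb 2 (1 + 2 * n / k)) :
    C * (b ^ 2 * k / L) * (1 + Real.log (1 + n / (b ^ 2 * k / L))) ≤ (k - 1) * Real.log 2 := by
  have hk0 : 0 < k := by linarith
  have hC0 : 0 < C := by linarith
  have hb0 : 0 < b := by rw [hb]; positivity
  have hb1 : b ≤ 1 := by
    rw [hb, div_le_one (by positivity)]
    linarith
  have hn0 : 0 < n := by linarith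
  set x := 2 * n / k with hx
  have hx1 : 1 ≤ x := by rw [hx, one_le_div hk0]; exact hkn
  have hlog2 := Real.log_two_gt_d9
  have hlog2' := Real.log_two_lt_d9
  have hLx : L * Real.log 2 = Real.log (1 + x) := by
    rw [hL, Real.logb, div_mul_cancel₀ _ (by linarith)]
  have hL1 : 1 ≤ L := by
    rw [hL, Real.le_logb_iff_rpow_le (by norm_num) (by linarith), Real.rpow_one]
    linarith
  have hL2 : L ≤ 2 * x := by
    have : Real.log (1 + x) ≤ x := by
      have := Real.log_le_sub_one_of_pos (show 0 < 1 + x by linarith)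
      linarith
    nlinarith
  have hL0 : 0 < L := by linarith
  have hnm : n / (b ^ 2 * k / L) = x * L / 2 / b ^ 2 := by
    rw [hx]; field_simp
  have h1 : 1 + n / (b ^ 2 * k / L) ≤ (1 + x) ^ 2 / b ^ 2 := by
    rw [hnm, le_div_iff₀ (by positivity), add_mul, div_mul_cancel₀ _ (by positivity)]
    nlinarith
  have h2 : Real.log (1 + n / (b ^ 2 * k / L)) ≤ 2 * L + 2 / b := by
    refine (Real.log_le_log (by positivity) h1).trans ?_
    rw [← div_pow, Real.log_pow, Real.log_div (by positivity) (by positivity), ← hLx]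
    have h3 : -Real.log b ≤ 1 / b := by
      rw [← Real.log_inv, one_div]
      have := Real.log_le_sub_one_of_pos (inv_pos.2 hb0)
      linarith
    have h4 : L * Real.log 2 ≤ L := by nlinarith
    have h5 : 2 / b = 2 * (1 / b) := by ring
    rw [h5]
    push_cast
    linarith
  have h3 : 1 + Real.log (1 + n / (b ^ 2 * k / L)) ≤ L * (5 / b) := by
    have h6 : 1 ≤ 1 / b := by rw [one_le_div hb0]; exact hb1
    have h7 : 2 / b = 2 * (1 / b) := by ring
    have h8 : L * (5 / b) = 5 * (L * (1 / b)) := by ring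
    rw [h7] at h2
    rw [h8]
    nlinarith
  calc C * (b ^ 2 * k / L) * (1 + Real.log (1 + n / (b ^ 2 * k / L)))
      ≤ C * (b ^ 2 * k / L) * (L * (5 / b)) := by gcongr
    _ = 5 * C * b * k := by field_simp
    _ = k / 4 := by rw [hb]; field_simp; norm_num
    _ ≤ (k - 1) * Real.log 2 := by nlinarith

theorem card_le_two_pow_of_le_exp {N k : ℕ} (hk : 1 ≤ k) {t : ℝ} (h : (N : ℝ) ≤ Real.exp t)
    (ht : t ≤ ((k : ℝ) - 1) * Real.log 2) : N ≤ 2 ^ (k - 1) := by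
  have h1 : (N : ℝ) ≤ 2 ^ (k - 1) := by
    refine h.trans ((Real.exp_le_exp.2 ht).trans_eq ?_)
    rw [show (k : ℝ) - 1 = ((k - 1 : ℕ) : ℝ) by rw [Nat.cast_sub hk, Nat.cast_one],
      Real.exp_nat_mul, Real.exp_log (by norm_num)]
  exact_mod_cast h1

theorem entropyNumber_le_of_le_two_mul {p q : ℝ≥0∞} (hp : 0 < p) (hpq : p ≤ q) :
    ∃ C : ℝ, 1 ≤ C ∧ ∀ n k : ℕ, 1 ≤ n → 1 ≤ k → (k : ℝ) ≤ 2 * n →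
      entropyNumber k (idC p q n)
        ≤ C * (Real.logb 2 (1 + 2 * n / k) / k) ^ ((1 / p).toReal - (1 / q).toReal) := by
  have hq : 0 < q := hp.trans_le hpq
  have hs : 0 ≤ (1 / p).toReal - (1 / q).toReal := sub_nonneg.2 (toReal_one_div_anti hp hpq)
  have triv : ∀ n k : ℕ, entropyNumber k (idC p q n) ≤ 1 := fun n k =>
    entropyNumber_le_of_ball_subset hp hq one_pos fun x hx => ellNorm_le_one_of_le hp hpq hx
  by_cases hp' : p = ∞
  · subst hp'
    obtain rfl : q = ∞ := top_le_iff.1 hpq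
    refine ⟨1, le_rfl, fun n k _ _ _ => ?_⟩
    rw [sub_self, Real.rpow_zero, mul_one]
    exact triv n k
  obtain ⟨C, hC, hcov⟩ := exists_lattice_cover hp hp'
  have hC0 : 0 < C := by linarith
  set b := 1 / (20 * C) with hb
  have hb0 : 0 < b := by positivity
  have hb1 : b ≤ 1 := by
    rw [hb, div_le_one (by positivity)]
    linarith
  have hC1 : 1 ≤ (b ^ 2) ^ (-((1 / p).toReal - (1 / q).toReal)) :=
    Real.one_le_rpow_of_pos_of_le_one_of_nonpos (by positivity) (by nlinarith) (by linarith)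
  refine ⟨_, hC1, fun n k hn hk hkn => ?_⟩
  have hn' : (1 : ℝ) ≤ n := by exact_mod_cast hn
  have hk' : (1 : ℝ) ≤ k := by exact_mod_cast hk
  set L := Real.logb 2 (1 + 2 * n / k) with hL
  have hL1 : 1 ≤ L := by
    rw [hL, Real.le_logb_iff_rpow_le (by norm_num) (by positivity), Real.rpow_one]
    have : 1 ≤ 2 * (n : ℝ) / k := by rw [one_le_div (by linarith)]; exact hkn
    linarith
  -- For `k = 1` no room is left in the exponent, but then `L / k ≥ 1` and the trivial bound
  -- suffices.
  rcases hk.eq_or_lt with rfl | hk2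
  · refine (triv n 1).trans ?_
    refine one_le_mul_of_one_le_of_one_le hC1 (Real.one_le_rpow ?_ hs)
    simpa using hL1
  have hk2' : (2 : ℝ) ≤ k := by exact_mod_cast hk2
  have hm : 0 < b ^ 2 * k / L := by positivity
  obtain ⟨Z, hZ, hZcov⟩ := hcov n _ hm
  have hr : (b ^ 2 * k / L) ^ ((1 / q).toReal - (1 / p).toReal)
      = (b ^ 2) ^ (-((1 / p).toReal - (1 / q).toReal))
        * (L / k) ^ ((1 / p).toReal - (1 / q).toReal) := by
    rw [← neg_sub (1 / p).toReal, mul_div_assoc, Real.mul_rpow (by positivity) (by positivity)]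
    congr 1
    rw [Real.rpow_neg (by positivity), ← Real.inv_rpow (by positivity), inv_div]
  rw [← hr]
  refine entropyNumber_le_of_cover hp hq (by positivity) Z
    (card_le_two_pow_of_le_exp hk hZ (lattice_exponent_le hC hk2' hkn hb hL)) fun x hx => ?_
  obtain ⟨z, hz, hxz⟩ := hZcov x hx
  exact ⟨z, hz, ellNorm_le_of_dominated hp hpq hm hx (fun i => (hxz i).1) fun i => (hxz i).2⟩

/-! ### Volume rate: upper bound by subdivision. -/

/-- Refining a cover by cubes of side comparable to `d` by a factor `s`. -/
theorem exists_refined_cover {n : ℕ} {d : ℝ} (hd : 0 < d) (Z : Finset (Fin n → ℂ)) {s : ℕ}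
    (hs : 1 ≤ s) : ∃ Y : Finset (Fin n → ℂ), (Y.card : ℝ) ≤ Z.card * (5 * (s : ℝ)) ^ (2 * n) ∧
      ∀ x : Fin n → ℂ, (∃ z ∈ Z, ∀ i, ‖x i - z i‖ ≤ d) → ∃ y ∈ Y, ∀ i, ‖x i - y i‖ ≤ d / s := by
  classical
  have hs0 : (0 : ℝ) < s := by exact_mod_cast hs
  -- A real or imaginary part of size at most `d`, rounded at mesh `d/s`, has index at most `2s` in
  -- absolute value; `4s + 1 ≤ 5s`.
  set I : Finset ℤ := Finset.Icc (-(2 * s : ℤ)) (2 * s) with hI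
  have hδ : 0 < d / s := by positivity
  refine ⟨(Z ×ˢ Fintype.piFinset fun _ : Fin n => I ×ˢ I).image
    fun u i => u.1 i + gridPoint (d / s) (u.2 i), ?_, ?_⟩
  · have h1 : I.card ≤ 5 * s := by rw [hI, Int.card_Icc]; omega
    have h2 : ((Z ×ˢ Fintype.piFinset fun _ : Fin n => I ×ˢ I).image
        fun u i => u.1 i + gridPoint (d / s) (u.2 i)).card ≤ Z.card * (5 * s) ^ (2 * n) := by
      refine Finset.card_image_le.trans ?_
      rw [Finset.card_product, Fintype.card_piFinset]
      simp only [Finset.card_product, Finset.prod_const, Finset.card_univ, Fintype.card_fin]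
      rw [pow_mul, sq]
      gcongr
    exact_mod_cast h2
  · rintro x ⟨z, hz, hxz⟩
    refine ⟨fun i => z i + gridPoint (d / s) (gridRound (d / s) (x i - z i)), ?_, fun i => ?_⟩
    · refine Finset.mem_image.2 ⟨(z, fun i => gridRound (d / s) (x i - z i)),
        Finset.mem_product.2 ⟨hz, Fintype.mem_piFinset.2 fun i => ?_⟩, rfl⟩
      have key : ∀ a : ℤ, |(a : ℝ)| ≤ 2 * ‖x i - z i‖ / (d / s) → a ∈ I := by
        intro a ha
        have h2 : |(a : ℝ)| ≤ 2 * s := by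
          refine ha.trans ?_
          rw [div_le_iff₀ hδ]
          calc 2 * ‖x i - z i‖ ≤ 2 * d := by linarith [hxz i]
            _ = 2 * s * (d / s) := by field_simp
        rw [hI, Finset.mem_Icc, ← abs_le]
        exact_mod_cast h2
      have h := abs_gridRound_le hδ (x i - z i)
      exact Finset.mem_product.2 ⟨key _ h.1, key _ h.2⟩
    · rw [← sub_sub]
      exact norm_sub_gridPoint_le hδ _

theorem two_rpow_pow_two_mul {n k : ℕ} (hn : 1 ≤ n) (hk : 1 ≤ k) :
    ((2 : ℝ) ^ (((k : ℝ) - 1) / (2 * n))) ^ (2 * n) = 2 ^ (k - 1) := by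
  have hn' : (0 : ℝ) < n := by exact_mod_cast hn
  rw [← Real.rpow_natCast, ← Real.rpow_mul (by norm_num), ← Real.rpow_natCast]
  congr 1
  rw [Nat.cast_sub hk]
  push_cast
  field_simp

theorem entropyNumber_le_of_large {p q : ℝ≥0∞} (hp : 0 < p) (hq : 0 < q) :
    ∃ A : ℝ, 1 ≤ A ∧ ∀ n k : ℕ, 1 ≤ n → 1 ≤ k → A ≤ (2 : ℝ) ^ (((k : ℝ) - 1) / (2 * n)) →
      entropyNumber k (idC p q n) ≤ 2 * A * ((2 : ℝ) ^ (-(((k : ℝ) - 1) / (2 * n))) *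
        (n : ℝ) ^ ((1 / q).toReal - (1 / p).toReal)) := by
  obtain ⟨A, hA, hcov⟩ := exists_sup_cover hp
  refine ⟨5 * A, by linarith, fun n k hn hk hAT => ?_⟩
  have hn' : (0 : ℝ) < n := by exact_mod_cast hn
  have hA0 : 0 < A := by linarith
  set T := (2 : ℝ) ^ (((k : ℝ) - 1) / (2 * n)) with hT
  have hT0 : 0 < T := by positivity
  -- The largest refinement the budget allows: `A^(2n) (5s)^(2n) ≤ T^(2n) = 2^(k-1)`. The hypothesis
  -- on `T` ensures `s ≥ 1`.
  set s := ⌊T / (5 * A)⌋₊ with hsdef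
  have hTA : 1 ≤ T / (5 * A) := by rw [one_le_div (by positivity)]; exact hAT
  have hs1 : 1 ≤ s := Nat.le_floor (by simpa using hTA)
  have hs0 : (1 : ℝ) ≤ s := by exact_mod_cast hs1
  have hs2 : (s : ℝ) ≤ T / (5 * A) := Nat.floor_le (by positivity)
  have hs3 : T / (5 * A) ≤ 2 * s := by
    have := Nat.lt_floor_add_one (T / (5 * A))
    rw [← hsdef] at this
    linarith
  obtain ⟨Z, hZ, hZcov⟩ := hcov n hn
  set d := (n : ℝ) ^ (-(1 / p).toReal) with hd
  have hd0 : 0 < d := by positivity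
  obtain ⟨Y, hY, hYcov⟩ := exists_refined_cover hd0 Z hs1
  have hcard : Y.card ≤ 2 ^ (k - 1) := by
    have : (Y.card : ℝ) ≤ 2 ^ (k - 1) := by
      calc (Y.card : ℝ) ≤ Z.card * (5 * (s : ℝ)) ^ (2 * n) := hY
        _ ≤ A ^ (2 * n) * (5 * (s : ℝ)) ^ (2 * n) := by
            gcongr
            exact hZ.trans (pow_le_pow_right₀ hA (by omega))
        _ = (s * (5 * A)) ^ (2 * n) := by rw [← mul_pow]; congr 1; ring
        _ ≤ T ^ (2 * n) := by
            gcongr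
            rwa [le_div_iff₀ (by positivity)] at hs2
        _ = 2 ^ (k - 1) := two_rpow_pow_two_mul hn hk
    exact_mod_cast this
  refine entropyNumber_le_of_cover hp hq (by positivity) Y hcard fun x hx => ?_
  obtain ⟨y, hy, hxy⟩ := hYcov x (hZcov x hx)
  refine ⟨y, hy, (ellNorm_le_of_forall_norm_le hq (by positivity) hxy).trans ?_⟩
  rw [Real.rpow_neg (by norm_num), ← hT, sub_eq_add_neg, Real.rpow_add hn', ← hd]
  have h1 : (1 : ℝ) / s ≤ 2 * (5 * A) * T⁻¹ := by
    rw [div_le_iff₀ (by positivity)]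
    rw [div_le_iff₀ (by positivity)] at hs3
    rw [← div_eq_mul_inv, div_mul_eq_mul_div, le_div_iff₀ hT0]
    linarith
  calc (n : ℝ) ^ (1 / q).toReal * (d / s) = (1 / s) * ((n : ℝ) ^ (1 / q).toReal * d) := by ring
    _ ≤ (2 * (5 * A) * T⁻¹) * ((n : ℝ) ^ (1 / q).toReal * d) := by gcongr
    _ = _ := by ring

/-! ### Volume rate: lower bound. -/

/-- Haar measure of sup-norm balls scales with the real dimension `2n`, and the volume of the unit
polydisc cancels. -/
theorem pow_le_card_mul_pow_of_cover {n : ℕ} {d ρ : ℝ} (hd : 0 ≤ d) (hρ : 0 ≤ ρ)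
    {ι : Type*} (s : Finset ι) (c : ι → Fin n → ℂ)
    (h : ∀ x : Fin n → ℂ, (∀ i, ‖x i‖ ≤ d) → ∃ j ∈ s, ∀ i, ‖x i - c j i‖ ≤ ρ) :
    d ^ (2 * n) ≤ s.card * ρ ^ (2 * n) := by
  have hfin : Module.finrank ℝ (Fin n → ℂ) = 2 * n := by
    rw [Module.finrank_pi_fintype]
    simp [Complex.finrank_real_complex, mul_comm]
  have hsub : Metric.closedBall (0 : Fin n → ℂ) d ⊆ ⋃ j ∈ s, Metric.closedBall (c j) ρ := by
    intro x hx
    rw [mem_closedBall_zero_iff, pi_norm_le_iff_of_nonneg hd] at hx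
    obtain ⟨j, hj, hxj⟩ := h x hx
    refine Set.mem_biUnion hj ?_
    rw [Metric.mem_closedBall, dist_pi_le_iff hρ]
    intro i
    rw [dist_eq_norm]
    exact hxj i
  set μ : MeasureTheory.Measure (Fin n → ℂ) := MeasureTheory.volume
  have h1 := (MeasureTheory.measure_mono (μ := μ) hsub).trans
    (MeasureTheory.measure_biUnion_finset_le s _)
  simp only [MeasureTheory.Measure.addHaar_closedBall μ _ hd,
    MeasureTheory.Measure.addHaar_closedBall μ _ hρ, hfin, Finset.sum_const, nsmul_eq_mul] at h1
  have hV0 : μ (Metric.ball 0 1) ≠ 0 := (Metric.measure_ball_pos μ _ one_pos).ne'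
  have hV1 : μ (Metric.ball 0 1) ≠ ∞ := MeasureTheory.measure_ball_lt_top.ne
  rw [← mul_assoc, ENNReal.mul_le_mul_iff_left hV0 hV1, ← ENNReal.ofReal_natCast,
    ← ENNReal.ofReal_mul (by positivity), ENNReal.ofReal_le_ofReal_iff (by positivity)] at h1
  exact h1

/-- `B_p` contains the polydisc of radius `n^(-1/p)`, while each translate of `r B_q` is covered by
at most `A^n` polydiscs of radius `r n^(-1/q)`. Thus only volumes of polydiscs are compared, never
those of `B_p` or `B_q`. -/
theorem le_entropyNumber_volume {p q : ℝ≥0∞} (hp : 0 < p) (hq : 0 < q) :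
    ∃ c : ℝ, 0 < c ∧ ∀ n k : ℕ, 1 ≤ n → 1 ≤ k →
      c * ((2 : ℝ) ^ (-(((k : ℝ) - 1) / (2 * n))) *
        (n : ℝ) ^ ((1 / q).toReal - (1 / p).toReal)) ≤ entropyNumber k (idC p q n) := by
  obtain ⟨A, hA, hcov⟩ := exists_sup_cover hq
  have hA0 : 0 < A := by linarith
  refine ⟨A⁻¹, by positivity, fun n k hn hk => le_entropyNumber hp hq fun r hr y hy => ?_⟩
  have hn' : (0 : ℝ) < n := by exact_mod_cast hn
  obtain ⟨Z, hZ, hZcov⟩ := hcov n hn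
  set T := (2 : ℝ) ^ (((k : ℝ) - 1) / (2 * n)) with hT
  have hT0 : 0 < T := by positivity
  set d := (n : ℝ) ^ (-(1 / p).toReal) with hd
  set e := (n : ℝ) ^ (-(1 / q).toReal) with he
  have hd0 : 0 < d := by positivity
  have he0 : 0 < e := by positivity
  have hr' : (r : ℂ) ≠ 0 := by exact_mod_cast hr.ne'
  have key := pow_le_card_mul_pow_of_cover hd0.le (mul_pos hr he0).le
    (Finset.univ ×ˢ Z) (fun u : Fin (2 ^ (k - 1)) × (Fin n → ℂ) => y u.1 + (r : ℂ) • u.2) (by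
      intro x hx
      have hx1 : ellNorm p x ≤ 1 := by
        refine (ellNorm_le_of_forall_norm_le hp hd0.le hx).trans_eq ?_
        rw [hd, ← Real.rpow_add hn', add_neg_cancel, Real.rpow_zero]
      obtain ⟨j, hj⟩ := hy x hx1
      have h1 : ellNorm q ((r : ℂ)⁻¹ • (x - y j)) ≤ 1 := by
        rw [ellNorm_smul hq, norm_inv, Complex.norm_real, Real.norm_of_nonneg hr.le,
          inv_mul_le_iff₀ hr, mul_one]
        exact hj
      obtain ⟨z, hz, hxz⟩ := hZcov _ h1
      refine ⟨(j, z), by simp [hz], fun i => ?_⟩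
      have h2 : x i - (y j + (r : ℂ) • z) i = (r : ℂ) * (((r : ℂ)⁻¹ • (x - y j)) i - z i) := by
        simp only [Pi.add_apply, Pi.smul_apply, Pi.sub_apply, smul_eq_mul]
        field_simp
        ring
      rw [h2, norm_mul, Complex.norm_real, Real.norm_of_nonneg hr.le]
      gcongr
      exact hxz i)
  have h3 : d ^ (2 * n) ≤ (T * A * (r * e)) ^ (2 * n) := by
    refine key.trans ?_
    rw [mul_pow (T * A) (r * e), mul_pow T A, two_rpow_pow_two_mul hn hk]
    gcongr
    rw [Finset.card_product, Finset.card_univ, Fintype.card_fin]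
    push_cast
    gcongr
    exact hZ.trans (pow_le_pow_right₀ hA (by omega))
  have h4 : d ≤ T * A * (r * e) :=
    le_of_pow_le_pow_left₀ (by omega) (by positivity) h3
  rw [Real.rpow_neg (by norm_num), ← hT, sub_eq_add_neg, Real.rpow_add hn', ← hd]
  have h5 : (n : ℝ) ^ (1 / q).toReal = e⁻¹ := by rw [he, Real.rpow_neg hn'.le, inv_inv]
  rw [h5]
  calc A⁻¹ * (T⁻¹ * (e⁻¹ * d)) ≤ A⁻¹ * (T⁻¹ * (e⁻¹ * (T * A * (r * e)))) := by gcongr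
    _ = r := by field_simp

/-! ### Lower bounds from separated sparse vectors. -/

theorem ellNorm_indicator_le {p : ℝ≥0∞} (hp : 0 < p) {n : ℕ} (S : Finset (Fin n)) {a : ℝ}
    (ha : 0 ≤ a) :
    ellNorm p (fun i => if i ∈ S then (a : ℂ) else 0) ≤ (S.card : ℝ) ^ (1 / p).toReal * a := by
  by_cases hp' : p = ∞
  · subst hp'
    rw [toReal_one_div_top, Real.rpow_zero, one_mul, ellNorm_top_le_iff ha]
    intro i
    split_ifs <;> simp [ha, abs_of_nonneg]
  · have h0 : 0 < p.toReal := ENNReal.toReal_pos hp.ne' hp'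
    rw [ellNorm_le_iff hp hp' (by positivity), Real.mul_rpow (by positivity) ha,
      toReal_one_div, Real.rpow_inv_rpow (by positivity) h0.ne']
    have : ∀ i, ‖(if i ∈ S then (a : ℂ) else 0)‖ ^ p.toReal
        = if i ∈ S then a ^ p.toReal else 0 := by
      intro i
      split_ifs
      · rw [Complex.norm_real, Real.norm_of_nonneg ha]
      · rw [norm_zero, Real.zero_rpow h0.ne']
    simp [this]

theorem card_rpow_mul_le_of_ellNorm_le {p : ℝ≥0∞} (hp : 0 < p) {n : ℕ} {S : Finset (Fin n)}
    (hS : S.Nonempty) {a R : ℝ} (ha : 0 ≤ a) {x : Fin n → ℂ} (hx : ∀ i ∈ S, a ≤ ‖x i‖)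
    (hR : 0 ≤ R) (h : ellNorm p x ≤ R) : (S.card : ℝ) ^ (1 / p).toReal * a ≤ R := by
  by_cases hp' : p = ∞
  · subst hp'
    obtain ⟨i, hi⟩ := hS
    rw [toReal_one_div_top, Real.rpow_zero, one_mul]
    exact (hx i hi).trans ((ellNorm_top_le_iff hR).1 h i)
  · have h0 : 0 < p.toReal := ENNReal.toReal_pos hp.ne' hp'
    rw [ellNorm_le_iff hp hp' hR] at h
    rw [← Real.rpow_le_rpow_iff (by positivity) hR h0, Real.mul_rpow (by positivity) ha,
      toReal_one_div, Real.rpow_inv_rpow (by positivity) h0.ne']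
    calc (S.card : ℝ) * a ^ p.toReal = ∑ i ∈ S, a ^ p.toReal := by simp
      _ ≤ ∑ i ∈ S, ‖x i‖ ^ p.toReal :=
          Finset.sum_le_sum fun i hi => Real.rpow_le_rpow ha (hx i hi) h0.le
      _ ≤ ∑ i, ‖x i‖ ^ p.toReal :=
          Finset.sum_le_univ_sum_of_nonneg fun i => by positivity
      _ ≤ R ^ p.toReal := h

theorem ellNorm_sub_le_of_same_ball {q : ℝ≥0∞} (hq : 0 < q) {n : ℕ} {x x' y : Fin n → ℂ} {r : ℝ}
    (hr : 0 ≤ r) (hx : ellNorm q (x - y) ≤ r) (hx' : ellNorm q (x' - y) ≤ r) :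
    ellNorm q (x - x') ≤ 2 * 2 ^ (1 / q).toReal * r := by
  simpa using ellNorm_sub_le hq hr hx hx'

/-- The zero vector and the unit vectors need different balls of small radius. -/
theorem le_entropyNumber_of_two_pow_le {p q : ℝ≥0∞} (hp : 0 < p) (hq : 0 < q) {n k : ℕ}
    (hk : 2 ^ (k - 1) ≤ n) :
    (2 * 2 ^ (1 / q).toReal)⁻¹ ≤ entropyNumber k (idC p q n) := by
  refine le_entropyNumber hp hq fun r hr y hy => ?_
  set S : Option (Fin n) → Finset (Fin n) := fun o => o.toFinset with hS
  set v : Option (Fin n) → Fin n → ℂ := fun o i => if i ∈ S o then ((1 : ℝ) : ℂ) else 0 with hv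
  have hv1 : ∀ o, ellNorm p (v o) ≤ 1 := fun o => by
    refine (ellNorm_indicator_le hp (S o) zero_le_one).trans ?_
    rw [mul_one]
    refine Real.rpow_le_one (by positivity) ?_ (toReal_one_div_nonneg p)
    cases o <;> simp [hS]
  choose j hj using fun o => hy (v o) (hv1 o)
  -- There are `n + 1 > 2^(k-1)` vectors, so two share a ball.
  obtain ⟨o, o', hne, hoo⟩ := Fintype.exists_ne_map_eq_of_card_lt j (by simp; omega)
  have hdiff : ∃ i, 1 ≤ ‖(v o - v o') i‖ := by
    rcases o with _ | i <;> rcases o' with _ | i'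
    · exact absurd rfl hne
    · exact ⟨i', by simp [hv, hS]⟩
    · exact ⟨i, by simp [hv, hS]⟩
    · refine ⟨i, ?_⟩
      have : i' ≠ i := fun h => hne (by rw [h])
      simp [hv, hS, this]
  obtain ⟨i, hi⟩ := hdiff
  have h1 := ellNorm_sub_le_of_same_ball hq hr.le (hj o) (hoo ▸ hj o')
  have h2 := norm_apply_le_of_ellNorm_le hq (by positivity) h1 i
  rw [inv_le_iff_one_le_mul₀' (by positivity)]
  exact hi.trans h2

/-- Give each disagreement the weight `1/B`. A word in the Hamming ball has weight at least
`B^(-d)`, and the total weight factorises with each factor at most `1 + B · (1/B) = 2`. -/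
theorem card_hamming_ball_le {m B : ℕ} (hB : 1 ≤ B) (f : Fin m → Fin B) (d : ℕ) :
    (Finset.univ.filter fun g : Fin m → Fin B =>
      (Finset.univ.filter fun j => f j ≠ g j).card ≤ d).card ≤ 2 ^ m * B ^ d := by
  have hB' : (1 : ℝ) ≤ B := by exact_mod_cast hB
  have hB0 : (B : ℝ) ≠ 0 := by positivity
  set w : Fin m → Fin B → ℝ := fun j b => if f j ≠ b then (B : ℝ)⁻¹ else 1 with hw
  have hw0 : ∀ j b, 0 ≤ w j b := fun j b => by
    simp only [hw]
    split_ifs <;> positivity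
  have h1 : ((Finset.univ.filter fun g : Fin m → Fin B =>
      (Finset.univ.filter fun j => f j ≠ g j).card ≤ d).card : ℝ) ≤ 2 ^ m * B ^ d := by
    calc ((Finset.univ.filter fun g : Fin m → Fin B =>
          (Finset.univ.filter fun j => f j ≠ g j).card ≤ d).card : ℝ)
        = ∑ g ∈ Finset.univ.filter fun g : Fin m → Fin B =>
          (Finset.univ.filter fun j => f j ≠ g j).card ≤ d, (1 : ℝ) := by simp
      _ ≤ ∑ g ∈ Finset.univ.filter fun g : Fin m → Fin B =>
          (Finset.univ.filter fun j => f j ≠ g j).card ≤ d, (∏ j, w j (g j)) * B ^ d := by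
          refine Finset.sum_le_sum fun g hg => ?_
          have hg' := (Finset.mem_filter.1 hg).2
          have h2 : ∏ j, w j (g j)
              = ((B : ℝ)⁻¹) ^ (Finset.univ.filter fun j => f j ≠ g j).card := by
            simp only [hw]
            rw [Finset.prod_ite]
            simp
          rw [h2, inv_pow, inv_mul_eq_div, one_le_div (by positivity)]
          exact pow_le_pow_right₀ hB' hg'
      _ ≤ ∑ g : Fin m → Fin B, (∏ j, w j (g j)) * B ^ d :=
          Finset.sum_le_univ_sum_of_nonneg fun g =>
            mul_nonneg (Finset.prod_nonneg fun j _ => hw0 j _) (by positivity)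
      _ = (∏ j, ∑ b, w j b) * B ^ d := by
          rw [← Finset.sum_mul, Finset.prod_univ_sum, Fintype.piFinset_univ]
      _ ≤ (∏ _j : Fin m, (2 : ℝ)) * B ^ d := by
          refine mul_le_mul_of_nonneg_right (Finset.prod_le_prod
            (fun j _ => Finset.sum_nonneg fun b _ => hw0 j b) fun j _ => ?_) (by positivity)
          calc ∑ b, w j b ≤ ∑ b, ((if f j = b then 1 else 0) + (B : ℝ)⁻¹) := by
                refine Finset.sum_le_sum fun b _ => ?_
                by_cases h : f j = b
                · simp [hw, h]
                · simp [hw, h]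
            _ = 2 := by
                rw [Finset.sum_add_distrib]
                simp [hB0]
                norm_num
      _ = 2 ^ m * B ^ d := by simp
  exact_mod_cast h1

/-- Choosing one coordinate in each of `m` disjoint blocks of size `B` turns words into `m`-sparse
vectors. If more words share a ball than a Hamming ball holds, two of them differ in more than `m/2`
places, so their vectors are at `ℓ_q` distance at least `(m/2)^(1/q) m^(-1/p)`. -/
theorem le_entropyNumber_sparse {p q : ℝ≥0∞} (hp : 0 < p) (hq : 0 < q) {n k m B : ℕ}
    (hm : 1 ≤ m) (hB : 1 ≤ B) (hmB : m * B ≤ n)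
    (hcard : 2 ^ (k - 1) * (2 ^ m * B ^ (m / 2)) < B ^ m) :
    (2 * 2 ^ (1 / q).toReal)⁻¹ * (2 : ℝ)⁻¹ ^ (1 / q).toReal *
      (m : ℝ) ^ ((1 / q).toReal - (1 / p).toReal) ≤ entropyNumber k (idC p q n) := by
  refine le_entropyNumber hp hq fun r hr y hy => ?_
  by_contra! hlt
  have hm0 : (0 : ℝ) < m := by exact_mod_cast hm
  obtain ⟨e⟩ : Nonempty (Fin m × Fin B ↪ Fin n) :=
    Function.Embedding.nonempty_of_card_le (by simpa using hmB)
  set a := (m : ℝ) ^ (-(1 / p).toReal) with ha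
  have ha0 : 0 < a := by positivity
  set S : (Fin m → Fin B) → Finset (Fin n) := fun f => Finset.univ.image fun j => e (j, f j) with hS
  set v : (Fin m → Fin B) → Fin n → ℂ := fun f i => if i ∈ S f then (a : ℂ) else 0 with hv
  have hv1 : ∀ f, ellNorm p (v f) ≤ 1 := fun f => by
    refine (ellNorm_indicator_le hp (S f) ha0.le).trans ?_
    have h1 : ((S f).card : ℝ) ≤ m := by
      have : (S f).card ≤ m := Finset.card_image_le.trans (by simp)
      exact_mod_cast this
    calc ((S f).card : ℝ) ^ (1 / p).toReal * a ≤ (m : ℝ) ^ (1 / p).toReal * a := by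
          gcongr
      _ = 1 := by rw [ha, ← Real.rpow_add hm0, add_neg_cancel, Real.rpow_zero]
  choose j hj using fun f => hy (v f) (hv1 f)
  obtain ⟨b, hb⟩ := Fintype.exists_lt_card_fiber_of_mul_lt_card (n := 2 ^ m * B ^ (m / 2)) j
    (by simpa using hcard)
  obtain ⟨f, hf⟩ : (Finset.univ.filter fun f => j f = b).Nonempty := by
    rw [← Finset.card_pos]; omega
  have hf' : j f = b := (Finset.mem_filter.1 hf).2
  refine absurd (card_hamming_ball_le hB f (m / 2)) (not_le.2 (hb.trans_le ?_))
  refine Finset.card_le_card fun g hg => ?_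
  have hg' : j g = b := (Finset.mem_filter.1 hg).2
  refine Finset.mem_filter.2 ⟨Finset.mem_univ _, ?_⟩
  by_contra! hD
  set D := Finset.univ.filter fun i => f i ≠ g i with hDdef
  have hD2 : (m : ℝ) ≤ 2 * D.card := by
    have : m ≤ 2 * D.card := by omega
    exact_mod_cast this
  set E := D.image fun i => e (i, f i) with hE
  have hEcard : E.card = D.card := Finset.card_image_of_injective _ fun i i' h => by
    have := e.injective h
    exact (Prod.ext_iff.1 this).1
  have hEne : E.Nonempty := by rw [← Finset.card_pos, hEcard]; omega
  have hdiff : ∀ i ∈ E, a ≤ ‖(v f - v g) i‖ := by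
    intro i hi
    obtain ⟨l, hl, rfl⟩ := Finset.mem_image.1 hi
    have hl' : f l ≠ g l := (Finset.mem_filter.1 hl).2
    have h1 : e (l, f l) ∈ S f := Finset.mem_image.2 ⟨l, Finset.mem_univ _, rfl⟩
    have h2 : e (l, f l) ∉ S g := by
      intro h
      obtain ⟨l', -, h'⟩ := Finset.mem_image.1 h
      have h3 := e.injective h'
      simp only [Prod.mk.injEq] at h3
      obtain ⟨rfl, h4⟩ := h3
      exact hl' h4.symm
    simp only [hv, Pi.sub_apply, if_pos h1, if_neg h2, sub_zero]
    rw [Complex.norm_real, Real.norm_of_nonneg ha0.le]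
  have h1 := ellNorm_sub_le_of_same_ball hq hr.le (hf' ▸ hj f) (hg' ▸ hj g)
  have h2 := card_rpow_mul_le_of_ellNorm_le hq hEne ha0.le hdiff (by positivity) h1
  rw [hEcard] at h2
  have h3 : ((2 : ℝ)⁻¹ * m) ^ (1 / q).toReal ≤ (D.card : ℝ) ^ (1 / q).toReal :=
    Real.rpow_le_rpow (by positivity) (by linarith) (toReal_one_div_nonneg q)
  rw [Real.mul_rpow (by norm_num) hm0.le] at h3
  have h4 : (2 : ℝ)⁻¹ ^ (1 / q).toReal * (m : ℝ) ^ (1 / q).toReal * a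
      ≤ 2 * 2 ^ (1 / q).toReal * r := (mul_le_mul_of_nonneg_right h3 ha0.le).trans h2
  rw [sub_eq_add_neg, Real.rpow_add hm0, ← ha, mul_assoc, ← div_eq_inv_mul,
    lt_div_iff₀ (by positivity)] at hlt
  linarith

/-- Fourth powers remove the floor in `m / 2`: the factors are then bounded by `B^m`, `B^m` and
`B^(2m)`, the first strictly because `k - 1 < k`. -/
theorem sparse_card_lt {k m B : ℕ} (hk : 1 ≤ k) (hB : 16 ≤ B) (h : 2 ^ (4 * k) ≤ B ^ m) :
    2 ^ (k - 1) * (2 ^ m * B ^ (m / 2)) < B ^ m := by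
  refine lt_of_pow_lt_pow_left₀ 4 (by positivity) ?_
  have h1 : 2 ^ ((k - 1) * 4) < B ^ m :=
    (Nat.pow_lt_pow_right (by norm_num) (by omega)).trans_le h
  have h2 : 2 ^ (m * 4) ≤ B ^ m := by
    rw [mul_comm, pow_mul]
    exact Nat.pow_le_pow_left (by norm_num; exact hB) m
  have h3 : B ^ (m / 2 * 4) ≤ B ^ (2 * m) := Nat.pow_le_pow_right (by omega) (by omega)
  calc (2 ^ (k - 1) * (2 ^ m * B ^ (m / 2))) ^ 4
      = 2 ^ ((k - 1) * 4) * (2 ^ (m * 4) * B ^ (m / 2 * 4)) := by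
        rw [mul_pow, mul_pow, ← pow_mul, ← pow_mul, ← pow_mul]
    _ < B ^ m * (B ^ m * B ^ (2 * m)) := by
        refine Nat.mul_lt_mul_of_lt_of_le h1 (Nat.mul_le_mul h2 h3) ?_
        positivity
    _ = (B ^ m) ^ 4 := by ring

theorem exists_sparse_parameters {n k : ℕ} (hk : 1 ≤ k) (hnk : 1000 * k ≤ n)
    (hlog : Real.logb 2 (2 * n) ≤ k) : ∃ m B : ℕ, 1 ≤ m ∧ 16 ≤ B ∧ m * B ≤ n ∧
      2 ^ (4 * k) ≤ B ^ m ∧ (m : ℝ) ≤ 10 * (k / Real.logb 2 (1 + 2 * n / k)) := by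
  have hk' : (1 : ℝ) ≤ k := by exact_mod_cast hk
  have hnk' : 1000 * (k : ℝ) ≤ n := by exact_mod_cast hnk
  have hk0 : (0 : ℝ) < k := by linarith
  have hn1 : (1000 : ℝ) ≤ n := by linarith
  set L := Real.logb 2 (1 + 2 * n / k) with hL
  set x := (n : ℝ) / k with hx
  have hx1 : 1000 ≤ x := by rw [hx, le_div_iff₀ hk0]; exact hnk'
  have hxL : 1 + 2 * (n : ℝ) / k = 1 + 2 * x := by rw [hx]; ring
  rw [hxL] at hL
  have hL1 : 1 ≤ L := by
    rw [hL, Real.le_logb_iff_rpow_le (by norm_num) (by linarith), Real.rpow_one]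
    linarith
  have hL0 : 0 < L := by linarith
  -- The only use of the lower bound on `k`: it gives `1 ≤ 2k/L`, so rounding `8k/L` up stays below
  -- `10k/L`.
  have hL2 : L ≤ 2 * k := by
    have h1 : L ≤ Real.logb 2 ((2 * n) ^ 2) := by
      rw [hL]
      apply Real.logb_le_logb_of_le (by norm_num) (by linarith)
      have : x ≤ n := by rw [hx]; exact div_le_self (by linarith) hk'
      nlinarith
    rw [Real.logb_pow] at h1
    push_cast at h1
    linarith
  set m := ⌈8 * (k / L)⌉₊ with hm
  have hkL : 1 / 2 ≤ (k : ℝ) / L := by rw [le_div_iff₀ hL0]; linarith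
  have hm1 : 1 ≤ m := Nat.one_le_iff_ne_zero.2 (Nat.ceil_pos.2 (by linarith)).ne'
  have hm8 : 8 * (k / L) ≤ m := Nat.le_ceil _
  have hm10 : (m : ℝ) ≤ 10 * (k / L) := by
    have := Nat.ceil_lt_add_one (show 0 ≤ 8 * ((k : ℝ) / L) by positivity)
    rw [← hm] at this
    linarith
  have hkLk : (k : ℝ) / L ≤ k := div_le_self hk0.le hL1
  have hm0 : (0 : ℝ) < m := by exact_mod_cast hm1
  have h16 : 16 * m ≤ n := by
    have : (16 : ℝ) * m ≤ n := by linarith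
    exact_mod_cast this
  have hB16 : 16 ≤ n / m := (Nat.le_div_iff_mul_le hm1).2 h16
  refine ⟨m, n / m, hm1, hB16, Nat.mul_div_le n m, ?_, hm10⟩
  set B := n / m with hB
  have hB1 : (16 : ℝ) ≤ B := by exact_mod_cast hB16
  have hBx : x / 20 ≤ B := by
    have h1 : n < m * (B + 1) := by
      have := Nat.lt_mul_div_succ n hm1
      simpa [hB] using this
    have h2 : (n : ℝ) < m * (B + 1) := by exact_mod_cast h1
    rw [hx, div_div, div_le_iff₀ (by positivity)]
    have h3 : (m : ℝ) * (B + 1) ≤ m * (2 * B) := by gcongr; linarith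
    have h4 : (m : ℝ) * (2 * B) ≤ (10 * k) * (2 * B) := by gcongr; linarith
    linarith
  -- `2^L = 1 + 2x ≤ (x/20)²` since `x ≥ 1000`; hence `B^(2m) ≥ 2^(L m) ≥ 2^(8k)`.
  have hB2 : (2 : ℝ) ^ L ≤ (B : ℝ) ^ 2 := by
    rw [hL, Real.rpow_logb (by norm_num) (by norm_num) (by linarith)]
    nlinarith
  have h5 : ((2 : ℝ) ^ (4 * k)) ^ 2 ≤ ((B : ℝ) ^ m) ^ 2 := by
    calc ((2 : ℝ) ^ (4 * k)) ^ 2 = (2 : ℝ) ^ ((8 : ℝ) * k) := by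
          rw [← pow_mul, ← Real.rpow_natCast]
          congr 1
          push_cast
          ring
      _ ≤ (2 : ℝ) ^ (L * m) := by
          apply Real.rpow_le_rpow_of_exponent_le (by norm_num)
          calc (8 : ℝ) * k = L * (8 * (k / L)) := by field_simp
            _ ≤ L * m := by gcongr
      _ = ((2 : ℝ) ^ L) ^ m := by rw [Real.rpow_mul_natCast (by norm_num)]
      _ ≤ ((B : ℝ) ^ 2) ^ m := by gcongr
      _ = ((B : ℝ) ^ m) ^ 2 := by rw [← pow_mul, ← pow_mul, mul_comm]
  have h6 : (2 : ℝ) ^ (4 * k) ≤ (B : ℝ) ^ m :=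
    le_of_pow_le_pow_left₀ (by norm_num) (by positivity) h5
  exact_mod_cast h6

theorem le_entropyNumber_of_le_two_mul {p q : ℝ≥0∞} (hp : 0 < p) (hpq : p ≤ q) :
    ∃ c : ℝ, 0 < c ∧ ∀ n k : ℕ, 1 ≤ n → 1 ≤ k → Real.logb 2 (2 * n) ≤ k → (k : ℝ) ≤ 2 * n →
      c * (Real.logb 2 (1 + 2 * n / k) / k) ^ ((1 / p).toReal - (1 / q).toReal)
        ≤ entropyNumber k (idC p q n) := by
  have hq : 0 < q := hp.trans_le hpq
  set s := (1 / p).toReal - (1 / q).toReal with hs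
  have hs0 : 0 ≤ s := sub_nonneg.2 (toReal_one_div_anti hp hpq)
  have hs' : (1 / q).toReal - (1 / p).toReal = -s := by rw [hs]; ring
  obtain ⟨c₁, hc₁, hvol⟩ := le_entropyNumber_volume hp hq
  set c₂ : ℝ := (2 * 2 ^ (1 / q).toReal)⁻¹ * (2 : ℝ)⁻¹ ^ (1 / q).toReal with hc₂
  have hc₂0 : 0 < c₂ := by positivity
  refine ⟨min (c₂ * 10 ^ (-s)) (c₁ / 2 * 11000 ^ (-s)), by positivity, fun n k hn hk hlog hkn => ?_⟩
  have hn' : (1 : ℝ) ≤ n := by exact_mod_cast hn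
  have hk' : (1 : ℝ) ≤ k := by exact_mod_cast hk
  set L := Real.logb 2 (1 + 2 * n / k) with hL
  have hL0 : 0 < L := by
    apply Real.logb_pos (by norm_num)
    have : 0 < 2 * (n : ℝ) / k := by positivity
    linarith
  have hLk : 0 ≤ (L / k) ^ s := by positivity
  -- Sparse vectors serve for `k` small relative to `n`. Otherwise `k` and `n` are comparable, `L ≤
  -- 11` because `2001 ≤ 2^11`, and the volume bound has the required order.
  by_cases hnk : 1000 * k ≤ n
  · obtain ⟨m, B, hm, hB, hmB, hpow, hmL⟩ := exists_sparse_parameters hk hnk hlog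
    have hm0 : (0 : ℝ) < m := by exact_mod_cast hm
    have h1 := le_entropyNumber_sparse hp hq hm (by omega) hmB (sparse_card_lt hk hB hpow)
    refine le_trans ?_ h1
    rw [hs', ← hc₂]
    calc min (c₂ * 10 ^ (-s)) (c₁ / 2 * 11000 ^ (-s)) * (L / k) ^ s
        ≤ c₂ * 10 ^ (-s) * (L / k) ^ s := by gcongr; exact min_le_left _ _
      _ = c₂ * (10 * (k / L)) ^ (-s) := by
          rw [mul_assoc, Real.mul_rpow (by norm_num) (by positivity),
            Real.rpow_neg (by positivity : 0 ≤ (k : ℝ) / L), ← Real.inv_rpow (by positivity),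
            inv_div]
      _ ≤ c₂ * (m : ℝ) ^ (-s) := by
          gcongr ?_ * ?_
          exact Real.rpow_le_rpow_of_nonpos hm0 hmL (by linarith)
  · have hnk' : (n : ℝ) ≤ 1000 * k := by
      have : n ≤ 1000 * k := by omega
      exact_mod_cast this
    refine le_trans ?_ (hvol n k hn hk)
    rw [hs']
    have hL11 : L ≤ 11 := by
      rw [hL, Real.logb_le_iff_le_rpow (by norm_num) (by positivity)]
      have h2 : 2 * (n : ℝ) / k ≤ 2000 := by
        rw [div_le_iff₀ (by linarith)]
        linarith
      have h3 : ((2 : ℝ) ^ (11 : ℝ)) = 2048 := by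
        rw [show (11 : ℝ) = ((11 : ℕ) : ℝ) by norm_num, Real.rpow_natCast]; norm_num
      rw [h3]
      linarith
    have hLn : L / k ≤ 11000 * (n : ℝ)⁻¹ := by
      rw [← div_eq_mul_inv, div_le_div_iff₀ (by linarith) (by linarith)]
      nlinarith
    have hhalf : (1 : ℝ) / 2 ≤ (2 : ℝ) ^ (-(((k : ℝ) - 1) / (2 * n))) := by
      have h4 : ((k : ℝ) - 1) / (2 * n) ≤ 1 := by
        rw [div_le_one (by linarith)]
        linarith
      calc (1 : ℝ) / 2 = (2 : ℝ) ^ (-1 : ℝ) := by rw [Real.rpow_neg_one]; norm_num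
        _ ≤ _ := Real.rpow_le_rpow_of_exponent_le (by norm_num) (by linarith)
    calc min (c₂ * 10 ^ (-s)) (c₁ / 2 * 11000 ^ (-s)) * (L / k) ^ s
        ≤ c₁ / 2 * 11000 ^ (-s) * (11000 * (n : ℝ)⁻¹) ^ s := by
          gcongr
          exact min_le_right _ _
      _ = c₁ * (1 / 2 * (n : ℝ) ^ (-s)) := by
          rw [Real.mul_rpow (by norm_num) (by positivity), Real.inv_rpow (by positivity),
            ← Real.rpow_neg (by positivity)]
          have : (11000 : ℝ) ^ (-s) * 11000 ^ s = 1 := by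
            rw [← Real.rpow_add (by norm_num), neg_add_cancel, Real.rpow_zero]
          linear_combination (c₁ / 2 * (n : ℝ) ^ (-s)) * this
      _ ≤ _ := by gcongr

/-! ### Completing the ranges and assembling the theorem. -/

theorem entropyNumber_le_of_ge {p q : ℝ≥0∞} (hq : 0 < q) (hqp : q ≤ p) :
    ∃ C : ℝ, 0 < C ∧ ∀ n k : ℕ, 1 ≤ n → 1 ≤ k →
      entropyNumber k (idC p q n) ≤ C * ((2 : ℝ) ^ (-(((k : ℝ) - 1) / (2 * n))) *
        (n : ℝ) ^ ((1 / q).toReal - (1 / p).toReal)) := by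
  have hp : 0 < p := hq.trans_le hqp
  obtain ⟨A, hA, h⟩ := entropyNumber_le_of_large hp hq
  refine ⟨2 * A, by linarith, fun n k hn hk => ?_⟩
  have hn' : (0 : ℝ) < n := by exact_mod_cast hn
  rcases le_or_gt A ((2 : ℝ) ^ (((k : ℝ) - 1) / (2 * n))) with hT | hT
  · exact h n k hn hk hT
  -- When `T < A` the exponential factor exceeds `1/A`, so a single ball is good enough.
  · refine (entropyNumber_le_of_ball_subset hp hq (by positivity) fun x hx =>
      ellNorm_le_rpow_of_ge hq hqp hn hx).trans ?_
    rw [← mul_assoc]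
    refine le_mul_of_one_le_left (by positivity) ?_
    rw [Real.rpow_neg (by norm_num), ← div_eq_mul_inv, one_le_div (by positivity)]
    linarith

theorem entropyNumber_le_of_two_mul_le {p q : ℝ≥0∞} (hp : 0 < p) (hpq : p ≤ q) :
    ∃ C : ℝ, 0 < C ∧ ∀ n k : ℕ, 1 ≤ n → 1 ≤ k → 2 * n ≤ k →
      entropyNumber k (idC p q n) ≤ C * ((2 : ℝ) ^ (-(((k : ℝ) - 1) / (2 * n))) *
        (n : ℝ) ^ ((1 / q).toReal - (1 / p).toReal)) := by
  have hq : 0 < q := hp.trans_le hpq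
  have hs0 := sub_nonneg.2 (toReal_one_div_anti hp hpq)
  obtain ⟨A, hA, h⟩ := entropyNumber_le_of_large hp hq
  obtain ⟨C, hC, hmid⟩ := entropyNumber_le_of_le_two_mul hp hpq
  refine ⟨2 * A * C, by positivity, fun n k hn hk hnk => ?_⟩
  have hn' : (0 : ℝ) < n := by exact_mod_cast hn
  rcases le_or_gt A ((2 : ℝ) ^ (((k : ℝ) - 1) / (2 * n))) with hT | hT
  · refine (h n k hn hk hT).trans ?_
    exact mul_le_mul_of_nonneg_right (le_mul_of_one_le_right (by positivity) hC) (by positivity)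
  -- When `T < A`, monotonicity reduces to index `2n`, where the middle-range logarithm equals 1.
  · refine (entropyNumber_anti hp hq hnk).trans
      ((hmid n (2 * n) hn (by omega) (by push_cast; rfl)).trans ?_)
    have h1 : 1 + 2 * (n : ℝ) / ((2 * n : ℕ) : ℝ) = 2 := by
      push_cast
      rw [div_self (by positivity)]
      norm_num
    have h2 : (1 / ((2 * n : ℕ) : ℝ)) ^ ((1 / p).toReal - (1 / q).toReal)
        ≤ (n : ℝ) ^ ((1 / q).toReal - (1 / p).toReal) := by
      rw [← neg_sub (1 / p).toReal, Real.rpow_neg hn'.le, ← Real.inv_rpow hn'.le]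
      refine Real.rpow_le_rpow (by positivity) ?_ hs0
      rw [← one_div]
      push_cast
      gcongr
      linarith
    have h3 : 1 ≤ 2 * A * (2 : ℝ) ^ (-(((k : ℝ) - 1) / (2 * n))) := by
      rw [Real.rpow_neg (by norm_num), ← div_eq_mul_inv, one_le_div (by positivity)]
      linarith
    rw [h1, Real.logb_self_eq_one (by norm_num)]
    calc C * (1 / ((2 * n : ℕ) : ℝ)) ^ ((1 / p).toReal - (1 / q).toReal)
        ≤ C * (n : ℝ) ^ ((1 / q).toReal - (1 / p).toReal) := by gcongr
      _ ≤ (2 * A * (2 : ℝ) ^ (-(((k : ℝ) - 1) / (2 * n))))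
            * (C * (n : ℝ) ^ ((1 / q).toReal - (1 / p).toReal)) :=
          le_mul_of_one_le_left (by positivity) h3
      _ = _ := by ring

theorem two_pow_pred_le_of_le_logb {n k : ℕ} (hn : 1 ≤ n) (hk : 1 ≤ k)
    (h : (k : ℝ) ≤ Real.logb 2 (2 * n)) : 2 ^ (k - 1) ≤ n := by
  have hn' : (0 : ℝ) < n := by exact_mod_cast hn
  rw [Real.le_logb_iff_rpow_le (by norm_num) (by positivity), Real.rpow_natCast] at h
  have h1 : 2 ^ k ≤ 2 * n := by exact_mod_cast h
  obtain ⟨l, rfl⟩ : ∃ l, k = l + 1 := ⟨k - 1, by omega⟩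
  rw [pow_succ] at h1
  simp only [Nat.add_sub_cancel]
  omega

theorem mainTheorem2 (p q : ℝ≥0∞) (hp : 0 < p) (hq : 0 < q) :
    (p ≤ q → ∃ c C : ℝ, 0 < c ∧ 0 < C ∧ ∀ n k : ℕ, 1 ≤ n → 1 ≤ k →
      ((k : ℝ) ≤ Real.logb 2 (2 * n) →
        c ≤ entropyNumber k (idC p q n) ∧ entropyNumber k (idC p q n) ≤ C) ∧
      (Real.logb 2 (2 * n) ≤ k → (k : ℝ) ≤ 2 * n →
        c * (Real.logb 2 (1 + 2 * n / k) / k) ^ ((1 / p).toReal - (1 / q).toReal)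
            ≤ entropyNumber k (idC p q n) ∧
          entropyNumber k (idC p q n)
            ≤ C * (Real.logb 2 (1 + 2 * n / k) / k) ^ ((1 / p).toReal - (1 / q).toReal)) ∧
      ((2 * n : ℝ) ≤ k →
        c * ((2 : ℝ) ^ (-((k - 1 : ℝ) / (2 * n))) * (n : ℝ) ^ ((1 / q).toReal - (1 / p).toReal))
            ≤ entropyNumber k (idC p q n) ∧
          entropyNumber k (idC p q n)
            ≤ C * ((2 : ℝ) ^ (-((k - 1 : ℝ) / (2 * n))) *
                (n : ℝ) ^ ((1 / q).toReal - (1 / p).toReal)))) ∧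
    (q ≤ p → ∃ c C : ℝ, 0 < c ∧ 0 < C ∧ ∀ n k : ℕ, 1 ≤ n → 1 ≤ k →
      c * ((2 : ℝ) ^ (-((k - 1 : ℝ) / (2 * n))) * (n : ℝ) ^ ((1 / q).toReal - (1 / p).toReal))
          ≤ entropyNumber k (idC p q n) ∧
        entropyNumber k (idC p q n)
          ≤ C * ((2 : ℝ) ^ (-((k - 1 : ℝ) / (2 * n))) *
              (n : ℝ) ^ ((1 / q).toReal - (1 / p).toReal))) := by
  obtain ⟨c₁, hc₁, hvol⟩ := le_entropyNumber_volume hp hq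
  constructor
  · intro hpq
    obtain ⟨c₂, hc₂, hmid⟩ := le_entropyNumber_of_le_two_mul hp hpq
    obtain ⟨C₂, hC₂, hmid'⟩ := entropyNumber_le_of_le_two_mul hp hpq
    obtain ⟨C₁, hC₁, hlarge⟩ := entropyNumber_le_of_two_mul_le hp hpq
    have hc₀ : (0 : ℝ) < (2 * 2 ^ (1 / q).toReal)⁻¹ := by positivity
    refine ⟨min (2 * 2 ^ (1 / q).toReal)⁻¹ (min c₁ c₂), max C₁ C₂,
      lt_min hc₀ (lt_min hc₁ hc₂), lt_max_of_lt_left hC₁, fun n k hn hk => ⟨?_, ?_, ?_⟩⟩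
    · intro h
      refine ⟨(min_le_left _ _).trans
        (le_entropyNumber_of_two_pow_le hp hq (two_pow_pred_le_of_le_logb hn hk h)), ?_⟩
      exact (entropyNumber_le_of_ball_subset hp hq one_pos fun x hx =>
        ellNorm_le_one_of_le hp hpq hx).trans (hC₂.trans (le_max_right _ _))
    · intro h h'
      have hL : 0 ≤ Real.logb 2 (1 + 2 * n / k) / k := by
        refine div_nonneg (Real.logb_nonneg (by norm_num) ?_) (by positivity)
        have : 0 ≤ 2 * (n : ℝ) / k := by positivity
        linarith
      exact ⟨(mul_le_mul_of_nonneg_right ((min_le_right _ _).trans (min_le_right _ _))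
          (Real.rpow_nonneg hL _)).trans (hmid n k hn hk h h'),
        (hmid' n k hn hk h').trans
          (mul_le_mul_of_nonneg_right (le_max_right _ _) (Real.rpow_nonneg hL _))⟩
    · intro h
      exact ⟨(mul_le_mul_of_nonneg_right ((min_le_right _ _).trans (min_le_left _ _))
          (by positivity)).trans (hvol n k hn hk),
        (hlarge n k hn hk (by exact_mod_cast h)).trans
          (mul_le_mul_of_nonneg_right (le_max_left _ _) (by positivity))⟩
  · intro hqp
    obtain ⟨C, hC, h⟩ := entropyNumber_le_of_ge hq hqp
    exact ⟨c₁, C, hc₁, hC, fun n k hn hk => ⟨hvol n k hn hk, h n k hn hk⟩⟩
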